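/- Let $(\Omega,\mathcal F,\mathbb P)$ be a probability space, and let $(X_k)_{k\in\mathbb Z}$ be a stationary sequence of real random variables with $\mathbb E(X_0)=0$ and $\mathbb E(X_0^2)<\infty$, and $(\mathcal F_k)_{k\in\mathbb Z}$ a filtration, given in either of the following two ways. (a) $T:\Omega\to\Omega$ is a bijective bi-measurable transformation preserving $\mathbb P$, $\mathcal F_0\subseteq\mathcal F$ is a $\sigma$-algebra with $\mathcal F_0\subseteq T^{-1}(\mathcal F_0)$, $X_0$ is $\mathcal F_0$-measurable, and $X_k=X_0\circ T^k$, $\mathcal F_k=T^{-k}(\mathcal F_0)$ for $k\in\mathbb Z$. (b) $(\xi_k)_{k\in\mathbb Z}$ is a stationary Markov chain on $(\Omega,\mathcal F,\mathbb P)$ with values in a measurable space and marginal law $\pi$, $f$ is a measurable function with $\int f^2\,d\pi<\infty$ and $\int f\,d\pi=0$, and $X_k=f(\xi_k)$, $\mathcal F_k=\sigma(\xi_i,\ i\le k)$ for $k\in\mathbb Z$. Put $S_n=\sum_{i=0}^{n-1}X_i$, $\mathbb E_0(\cdot)=\mathbb E(\cdot\mid\mathcal F_0)$, let $\|\cdot\|$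 be the norm of $L^2(\Omega,\mathcal F,\mathbb P)$, and $\log_2 n=\log(\log(\max(e,n)))$. Assume that $$\sum_{n\ge1}\frac{\log n}{n}\Big(\sum_{k\ge n}\frac{\|\mathbb E_0(S_k)\|}{k^{3/2}}\Big)^2<\infty .$$ Then there is a stationary sequence $(D_k)_{k\in\mathbb Z}$ of square integrable random variables such that $D_k$ is $\mathcal F_{k+1}$-measurable and $\mathbb E(D_k\mid\mathcal F_k)=0$ a.s. for every $k\in\mathbb Z$ (so that $M_n=\sum_{i=0}^{n-1}D_i$ is a martingale with respect to $(\mathcal F_n)_{n\ge0}$ with stationary and square integrable differences), and $$\frac{S_n-M_n}{(n\log_2 n)^{1/2}}\longrightarrow 0\quad\text{a.s. as } n\to\infty .$$ In case (a) one can take $D_k=D_0\circ T^k$ for every $k\in\mathbb Z$. -/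

import Mathlib

open MeasureTheory ProbabilityTheory Filter Topology

namespace MartApprox

/-- The iterate `T ^ k`, `k ∈ ℤ`, of a bijective bi-measurable map `T`. -/
def iter {Ω : Type*} {_ : MeasurableSpace Ω} (T : Ω ≃ᵐ Ω) (k : ℤ) : Ω → Ω :=
  ((T.toEquiv : Equiv.Perm Ω) ^ k : Equiv.Perm Ω)

theorem iter_succ {Ω : Type*} {_ : MeasurableSpace Ω} (T : Ω ≃ᵐ Ω) (k : ℤ) :
    iter T (k + 1) = T ∘ iter T k := by
  funext ω
  simp only [iter, add_comm k 1, zpow_add, zpow_one, Equiv.Perm.mul_apply, Function.comp_apply]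
  rfl

theorem measurable_iter {Ω : Type*} {_ : MeasurableSpace Ω} (T : Ω ≃ᵐ Ω) (k : ℤ) :
    Measurable (iter T k) := by
  induction k using Int.induction_on with
  | zero => simpa [iter] using measurable_id
  | succ n ih => rw [iter_succ]; exact T.measurable.comp ih
  | pred n ih =>
    have h : iter T (-(n : ℤ) - 1) = T.symm ∘ iter T (-(n : ℤ)) := by
      have h' := iter_succ T (-(n : ℤ) - 1)
      rw [sub_add_cancel] at h'
      rw [h']
      funext ω
      simp
    rw [h]
    exact T.symm.measurable.comp ih

/-- The filtration `ℱ_k = T ^ {-k}(ℱ₀)`, where `ℱ₀ ⊆ T⁻¹(ℱ₀)`. Here `F₀.comap g` is the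
σ-algebra of all `g⁻¹(A)` with `A ∈ F₀`. -/
def shiftFiltration {Ω : Type*} {mΩ : MeasurableSpace Ω} (T : Ω ≃ᵐ Ω) (F₀ : MeasurableSpace Ω)
    (hF₀ : F₀ ≤ mΩ) (hT : F₀ ≤ F₀.comap T) : Filtration ℤ mΩ where
  seq k := F₀.comap (iter T k)
  mono' := by
    refine monotone_int_of_le_succ fun k => ?_
    rw [iter_succ, ← MeasurableSpace.comap_comp]
    exact MeasurableSpace.comap_mono hT
  le' k := (MeasurableSpace.comap_mono hF₀).trans (measurable_iter T k).comap_le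

/-- The filtration of the past of a process: `ℱ_k` is generated by the `ξ i` with `i ≤ k`. -/
def pastFiltration {Ω S : Type*} [mΩ : MeasurableSpace Ω] [mS : MeasurableSpace S]
    (ξ : ℤ → Ω → S) (hξ : ∀ k, Measurable (ξ k)) : Filtration ℤ mΩ where
  seq k := ⨆ i : Set.Iic k, mS.comap (ξ i)
  mono' _ l hkl := iSup_le fun i =>
    le_iSup (fun j : Set.Iic l => mS.comap (ξ j)) ⟨i.1, le_trans i.2 hkl⟩
  le' _ := iSup_le fun i => (hξ i).comap_le

/-- The restriction of a filtration indexed by `ℤ` to the nonnegative times. -/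
def natRestrict {Ω : Type*} {mΩ : MeasurableSpace Ω} (ℱ : Filtration ℤ mΩ) :
    Filtration ℕ mΩ where
  seq n := ℱ (n : ℤ)
  mono' _ _ h := ℱ.mono (Int.ofNat_le.mpr h)
  le' n := ℱ.le n

/-- (Strict) stationarity: the law of the whole sequence is invariant under time shifts. -/
def IsStationary {Ω E : Type*} [MeasurableSpace Ω] [MeasurableSpace E]
    (Y : ℤ → Ω → E) (μ : Measure Ω) : Prop :=
  ∀ m : ℤ, IdentDistrib (fun ω k => Y (k + m) ω) (fun ω k => Y k ω) μ μ

/-- A stationary Markov chain `(ξ_k)_{k ∈ ℤ}`: for every measurable `A`,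
`P(ξ_{k+1} ∈ A | ξ_i, i ≤ k) = P(ξ_{k+1} ∈ A | ξ_k)` almost surely. -/
def IsStationaryMarkovChain {Ω S : Type*} [MeasurableSpace Ω] [mS : MeasurableSpace S]
    (ξ : ℤ → Ω → S) (hξ : ∀ k, Measurable (ξ k)) (μ : Measure Ω) : Prop :=
  IsStationary ξ μ ∧
  ∀ (k : ℤ) (A : Set S), MeasurableSet A →
    μ[(ξ (k + 1) ⁻¹' A).indicator (fun _ => (1 : ℝ)) | pastFiltration ξ hξ k] =ᵐ[μ]
      μ[(ξ (k + 1) ⁻¹' A).indicator (fun _ => (1 : ℝ)) | mS.comap (ξ k)]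

/-- `S_n = X_0 + ⋯ + X_{n-1}`. -/
def partialSum {Ω : Type*} (X : ℤ → Ω → ℝ) (n : ℕ) (ω : Ω) : ℝ :=
  ∑ i ∈ Finset.range n, X (i : ℤ) ω

/-- The condition `∑_{n ≥ 1} (log n / n) (∑_{k ≥ n} ‖E(S_k | ℱ₀)‖₂ / k^{3/2})² < ∞`, as a series
in `[0, ∞]`; in particular every inner series is finite. -/
def LogCondition {Ω : Type*} {_ : MeasurableSpace Ω} (μ : Measure Ω) (F₀ : MeasurableSpace Ω)
    (X : ℤ → Ω → ℝ) : Prop :=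
  ∑' n : Set.Ici (1 : ℕ), ENNReal.ofReal (Real.log (n : ℕ) / (n : ℕ)) *
    (∑' k : Set.Ici (n : ℕ),
      eLpNorm (μ[partialSum X (k : ℕ) | F₀]) 2 μ / ((k : ℕ) : ENNReal) ^ (3 / 2 : ℝ)) ^ 2 < ⊤

/-- `(D_k)_{k ∈ ℤ}` is a stationary sequence of square integrable martingale differences adapted to
`(ℱ_{k+1})`, and `M_n = D_0 + ⋯ + D_{n-1}` is a martingale with respect to `(ℱ_n)_{n ≥ 0}`. -/
structure IsStationaryMartingaleDiff {Ω : Type*} {mΩ : MeasurableSpace Ω} (μ : Measure Ω)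
    (ℱ : Filtration ℤ mΩ) (D : ℤ → Ω → ℝ) : Prop where
  adapted : ∀ k, StronglyMeasurable[ℱ (k + 1)] (D k)
  memLp : ∀ k, MemLp (D k) 2 μ
  stationary : IsStationary D μ
  condExp_eq_zero : ∀ k, μ[D k | ℱ k] =ᵐ[μ] 0
  martingale : Martingale (partialSum D) (natRestrict ℱ) μ

/-- `log₂ x = log (log (max (e, x)))`, the iterated logarithm. -/
noncomputable def log₂ (x : ℝ) : ℝ := Real.log (Real.log (max (Real.exp 1) x))

/-- `(S_n - M_n) / (n log₂ n)^{1/2} → 0` almost surely, where `S`, `M` are the partial sums of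
`X`, `D`. -/
def LogApprox {Ω : Type*} {_ : MeasurableSpace Ω} (μ : Measure Ω) (X D : ℤ → Ω → ℝ) : Prop :=
  ∀ᵐ ω ∂μ, Tendsto
    (fun n : ℕ => (partialSum X n ω - partialSum D n ω) / √((n : ℝ) * log₂ (n : ℝ)))
    atTop (𝓝 0)

end MartApprox

/-! Let `K` be the space of square integrable `ℱ₀`-measurable functions, `P` the orthogonal
projection onto it and `U` the composition with `T`, an isometry with `K ⊆ U K`. The compression `V
= P U` is a contraction and `E₀(S_n) = ∑_{i<n} Vⁱ X₀`.

Approximation in `L²`: averaging the partial sums of the Neumann series of `V` up to `m = 2 ^ s`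
gives `θ` with `X₀ = θ - Vθ + h`, that is `X₀ = (Uθ - Vθ) + (θ - Uθ) + h`: a martingale difference,
a coboundary and a remainder. A dyadic maximal-type bound, `norm_opSum_two_pow_le`, controls the
sums of `h`. Martingale sums of length `n` have norm exactly `√n ‖d‖`, so the differences obtained
for varying `s` form a Cauchy sequence. In the limit (`exists_martingaleDiff_approx`), `R = S - M`
satisfies `‖R_n‖ ≤ 256 √n ∑_{k≥n} ‖E₀(S_k)‖ k^{-3/2}` for `n = 2 ^ s`, and the hypothesis becomes `∑
(j + 1) 2⁻ʲ ‖R_{2ʲ}‖² < ∞`.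

Almost sure rate: dyadic chaining (`abs_sub_le_sum_sqrt`) bounds `|R_k|`, `k < 2 ^ r`, by the sum
over `j < r` of the square roots of `2⁻ʲ ∑_{i<2^r} (R_{2ʲ} ∘ Tⁱ)²`. Cauchy–Schwarz with weights `1 /
(j + 1)` costs `1 + log r`, which is of the order of the iterated logarithm of `2 ^ r`. The maximal
ergodic inequality makes the other factor at most `2 ^ r δ²` once finitely many scales are set
aside, and those contribute only `O(2^{r/2})`.

The Markov chain case is the first case for the shift on path space, pulled back along `ω ↦
(ξ_k(ω))_k`. -/

namespace MartApprox

/-! ### Contractions and averaged Neumann series -/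

section Contraction

variable {H : Type*} [NormedAddCommGroup H] [InnerProductSpace ℝ H]

theorem norm_pow_apply_le {V : H →L[ℝ] H} (hV : ∀ x, ‖V x‖ ≤ ‖x‖) (n : ℕ) (x : H) :
    ‖(V ^ n) x‖ ≤ ‖x‖ := by
  induction n with
  | zero => simp
  | succ n ih => rw [pow_succ']; exact (hV _).trans ih

theorem norm_pow_apply {U : H →L[ℝ] H} (hU : ∀ x, ‖U x‖ = ‖x‖) (n : ℕ) (x : H) :
    ‖(U ^ n) x‖ = ‖x‖ := by
  induction n with
  | zero => simp
  | succ n ih => rw [pow_succ']; exact (hU _).trans ih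

theorem inner_pow_apply {U : H →L[ℝ] H} (hU : ∀ x, ‖U x‖ = ‖x‖) (n : ℕ) (x y : H) :
    inner ℝ ((U ^ n) x) ((U ^ n) y) = inner ℝ x y :=
  (LinearMap.norm_map_iff_inner_map_map (U ^ n)).1 (norm_pow_apply hU n) x y

/-- The sums `1 + V + ⋯ + V ^ (n - 1)` of iterates of an operator. -/
noncomputable def opSum (V : H →L[ℝ] H) (n : ℕ) : H →L[ℝ] H := ∑ i ∈ Finset.range n, V ^ i

theorem opSum_succ (V : H →L[ℝ] H) (n : ℕ) : opSum V (n + 1) = opSum V n + V ^ n :=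
  Finset.sum_range_succ _ _

theorem opSum_add (V : H →L[ℝ] H) (m n : ℕ) : opSum V (m + n) = opSum V m + V ^ m * opSum V n := by
  simp only [opSum, Finset.sum_range_add, pow_add, Finset.mul_sum]

theorem opSum_commute (V : H →L[ℝ] H) (m n : ℕ) : Commute (opSum V m) (opSum V n) :=
  Commute.sum_left _ _ _ fun i _ => Commute.sum_right _ _ _ fun j _ => Commute.pow_pow_self V i j

theorem opSum_commute_self (V : H →L[ℝ] H) (n : ℕ) : Commute V (opSum V n) :=
  Commute.sum_right _ _ _ fun j _ => Commute.self_pow V j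

theorem norm_opSum_apply_le {V : H →L[ℝ] H} (hV : ∀ x, ‖V x‖ ≤ ‖x‖) (n : ℕ) (x : H) :
    ‖opSum V n x‖ ≤ n * ‖x‖ := by
  rw [opSum, sum_apply]
  refine (norm_sum_le _ _).trans ((Finset.sum_le_card_nsmul _ _ ‖x‖ fun i _ =>
    norm_pow_apply_le hV i x).trans ?_)
  simp

/-- The sum of length `m` is the sum of length `m + n` minus its last block, which is `V ^ m`
applied to a sum of length `n`. This lets one term be dominated by an average over later ones. -/
theorem norm_opSum_apply_le_add {V : H →L[ℝ] H} (hV : ∀ x, ‖V x‖ ≤ ‖x‖) (m n : ℕ) (x : H) :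
    ‖opSum V m x‖ ≤ ‖opSum V (m + n) x‖ + ‖opSum V n x‖ := by
  have h : opSum V m x = opSum V (m + n) x - (V ^ m) (opSum V n x) := by
    rw [opSum_add]; simp
  rw [h]
  exact (norm_sub_le _ _).trans (by gcongr; exact norm_pow_apply_le hV m _)

/-- The Cesàro averages of the partial sums of the Neumann series of `V`. -/
noncomputable def cesaroNeumann (V : H →L[ℝ] H) (m : ℕ) (f : H) : H :=
  (m : ℝ)⁻¹ • ∑ i ∈ Finset.range m, opSum V (i + 1) f

/-- Each partial sum inverts `1 - V` up to a power of `V`. Averaging turns these powers into a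
Cesàro mean, which is small as soon as `opSum V m f` is `o(m)`. -/
theorem cesaroNeumann_sub (V : H →L[ℝ] H) {m : ℕ} (hm : m ≠ 0) (f : H) :
    f = cesaroNeumann V m f - V (cesaroNeumann V m f) + (m : ℝ)⁻¹ • V (opSum V m f) := by
  have h : ∀ i : ℕ, opSum V i f - V (opSum V i f) = f - (V ^ i) f := by
    intro i
    have := congrArg (fun W : H →L[ℝ] H => W f) (mul_neg_geom_sum V i)
    simpa [opSum] using this
  have h1 : cesaroNeumann V m f - V (cesaroNeumann V m f) =
      (m : ℝ)⁻¹ • ∑ i ∈ Finset.range m, (f - (V ^ (i + 1)) f) := by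
    simp only [cesaroNeumann, map_smul, map_sum, ← smul_sub, ← Finset.sum_sub_distrib, h]
  have h2 : V (opSum V m f) = ∑ i ∈ Finset.range m, (V ^ (i + 1)) f := by
    simp [opSum, pow_succ']
  have hm' : (m : ℝ) ≠ 0 := by exact_mod_cast hm
  rw [h1, h2, ← smul_add, ← Finset.sum_add_distrib]
  simp [← Nat.cast_smul_eq_nsmul ℝ, smul_smul, hm']

theorem norm_cesaroNeumann_le (V : H →L[ℝ] H) {m : ℕ} {f : H} {c : ℝ} (hc : 0 ≤ c)
    (h : ∀ i ≤ m, ‖opSum V i f‖ ≤ c) : ‖cesaroNeumann V m f‖ ≤ c := by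
  rcases Nat.eq_zero_or_pos m with rfl | hm
  · simpa [cesaroNeumann] using hc
  have hm' : (0 : ℝ) < m := by exact_mod_cast hm
  rw [cesaroNeumann, norm_smul, norm_inv, Real.norm_natCast, inv_mul_le_iff₀ hm']
  refine (norm_sum_le _ _).trans ((Finset.sum_le_card_nsmul _ _ c fun i hi =>
    h _ (Finset.mem_range.1 hi)).trans ?_)
  simp

end Contraction

/-! ### Isometries `U` with `K ⊆ U K` -/

section Shift

variable {H : Type*} [NormedAddCommGroup H] [InnerProductSpace ℝ H]
  {U : H →L[ℝ] H} {K : Submodule ℝ H}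

theorem exists_pow_apply_eq (hK : ∀ x ∈ K, ∃ y ∈ K, U y = x) {x : H} (hx : x ∈ K) (n : ℕ) :
    ∃ y ∈ K, (U ^ n) y = x := by
  induction n with
  | zero => exact ⟨x, hx, by simp⟩
  | succ n ih =>
    obtain ⟨y, hy, rfl⟩ := ih
    obtain ⟨z, hz, rfl⟩ := hK y hy
    exact ⟨z, hz, by rw [pow_succ]; rfl⟩

/-- The Hilbert space form of the `ℱ_n`-measurability of a martingale-type sum: the spaces `U ^ n K`
increase with `n`. -/
theorem exists_pow_apply_eq_opSum (hK : ∀ x ∈ K, ∃ y ∈ K, U y = x) {x : H}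
    (hx : ∃ y ∈ K, U y = x) (n : ℕ) : ∃ y ∈ K, (U ^ n) y = opSum U n x := by
  induction n with
  | zero => exact ⟨0, K.zero_mem, by simp [opSum]⟩
  | succ n ih =>
    obtain ⟨y, hy, h⟩ := ih
    obtain ⟨z, hz, hzy⟩ := hK y hy
    obtain ⟨w, hw, hwx⟩ := hx
    refine ⟨z + w, K.add_mem hz hw, ?_⟩
    rw [opSum_succ, map_add, add_apply, ← h, ← hwx, ← hzy, pow_succ]
    rfl

end Shift

/-! ### Martingale approximation in Hilbert space -/

section Projection

variable {H : Type*} [NormedAddCommGroup H] [InnerProductSpace ℝ H]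
  {U : H →L[ℝ] H} {K : Submodule ℝ H} [K.HasOrthogonalProjection]

/-- The compression of an operator to a subspace, seen as an operator on the whole space. -/
noncomputable def compression (K : Submodule ℝ H) [K.HasOrthogonalProjection] (U : H →L[ℝ] H) :
    H →L[ℝ] H := K.starProjection * U

theorem norm_starProjection_apply_le_norm (x : H) : ‖K.starProjection x‖ ≤ ‖x‖ :=
  (K.starProjection.le_opNorm x).trans
    (mul_le_of_le_one_left (norm_nonneg _) K.starProjection_norm_le)

theorem norm_compression_apply_le (hU : ∀ x, ‖U x‖ = ‖x‖) (x : H) :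
    ‖compression K U x‖ ≤ ‖x‖ :=
  (norm_starProjection_apply_le_norm _).trans (hU x).le

/-- Vectors orthogonal to `K` are sent by `U` to vectors orthogonal to `U K`, hence to `K`. So `P U`
only sees the component in `K`, and `P U ^ i = V ^ i P` follows. -/
theorem starProjection_mul_mul (hU : ∀ x, ‖U x‖ = ‖x‖) (hK : ∀ x ∈ K, ∃ y ∈ K, U y = x) :
    compression K U * K.starProjection = K.starProjection * U := by
  ext x
  have h : K.starProjection (U (x - K.starProjection x)) = 0 := by
    rw [Submodule.starProjection_apply_eq_zero_iff, Submodule.mem_orthogonal']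
    intro k hk
    obtain ⟨y, hy, rfl⟩ := hK k hk
    have := inner_pow_apply hU 1 (x - K.starProjection x) y
    rw [pow_one] at this
    rw [this]
    exact K.starProjection_inner_eq_zero x y hy
  simp only [map_sub, sub_eq_zero] at h
  simpa [compression] using h.symm

theorem starProjection_opSum_apply (hU : ∀ x, ‖U x‖ = ‖x‖) (hK : ∀ x ∈ K, ∃ y ∈ K, U y = x)
    (n : ℕ) {x : H} (hx : x ∈ K) :
    K.starProjection (opSum U n x) = opSum (compression K U) n x := by
  have h : ∀ i, K.starProjection * U ^ i = compression K U ^ i * K.starProjection := by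
    intro i
    induction i with
    | zero => simp
    | succ i ih =>
      rw [pow_succ', ← mul_assoc, ← starProjection_mul_mul hU hK, mul_assoc, ih, ← mul_assoc,
        pow_succ']
  have h' := congrArg (fun W : H →L[ℝ] H => W x)
    (Finset.sum_congr (rfl : Finset.range n = Finset.range n) fun i _ => h i)
  simpa [opSum, K.starProjection_eq_self_iff.2 hx] using h'

theorem compression_apply_mem (x : H) : compression K U x ∈ K := K.starProjection_apply_mem _

theorem opSum_compression_mem {x : H} (hx : x ∈ K) (n : ℕ) : opSum (compression K U) n x ∈ K := by
  rw [opSum, sum_apply]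
  refine K.sum_mem fun i _ => ?_
  cases i with
  | zero => simpa using hx
  | succ i => rw [pow_succ']; exact compression_apply_mem _

/-- The cross term between the two halves `s` and `U ^ n s` is small: `s = U ^ n y` with `y ∈ K`, so
it equals `⟨y, s⟩ = ⟨y, P s⟩`. Completing the square gives the factor `1 / 2`. -/
theorem norm_opSum_two_mul_le (hU : ∀ x, ‖U x‖ = ‖x‖) (hK : ∀ x ∈ K, ∃ y ∈ K, U y = x) {x : H}
    (hx : x ∈ K) (n : ℕ) :
    ‖opSum U (2 * n) x‖ ≤
      √2 * (‖opSum U n x‖ + ‖K.starProjection (opSum U n x)‖ / 2) := by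
  set s := opSum U n x with hs
  obtain ⟨y, hy, hys⟩ := exists_pow_apply_eq_opSum hK (hK x hx) n
  have hsum : opSum U (2 * n) x = s + (U ^ n) s := by
    rw [two_mul, opSum_add]; rfl
  have hin : inner ℝ s ((U ^ n) s) ≤ ‖s‖ * ‖K.starProjection s‖ := by
    have hny : ‖y‖ = ‖s‖ := by rw [hs, ← hys, norm_pow_apply hU]
    have h1 : inner ℝ s ((U ^ n) s) = inner ℝ y (K.starProjection s) := by
      conv_lhs => rw [hs, ← hys]
      rw [inner_pow_apply hU, hys, ← hs]
      have h2 := K.starProjection_isSymmetric y s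
      simpa [K.starProjection_eq_self_iff.2 hy] using h2
    rw [h1, ← hny]
    exact real_inner_le_norm _ _
  refine le_of_sq_le_sq ?_ (by positivity)
  rw [hsum, norm_add_sq_real, norm_pow_apply hU, mul_pow, Real.sq_sqrt (by norm_num)]
  nlinarith [sq_nonneg ‖K.starProjection s‖]

theorem norm_opSum_two_pow_le (hU : ∀ x, ‖U x‖ = ‖x‖) (hK : ∀ x ∈ K, ∃ y ∈ K, U y = x) {x : H}
    (hx : x ∈ K) (r : ℕ) :
    ‖opSum U (2 ^ r) x‖ ≤ √2 ^ r * (‖x‖ + (∑ j ∈ Finset.range r,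
      (√2 ^ j)⁻¹ * ‖K.starProjection (opSum U (2 ^ j) x)‖) / 2) := by
  induction r with
  | zero => simp [opSum]
  | succ r ih =>
    rw [pow_succ']
    refine (norm_opSum_two_mul_le hU hK hx _).trans ?_
    rw [pow_succ' √2, mul_assoc, Finset.sum_range_succ]
    gcongr
    refine (add_le_add_left ih _).trans (le_of_eq ?_)
    have : √2 ^ r ≠ 0 := by positivity
    field_simp
    ring

theorem norm_opSum_of_orthogonal (hU : ∀ x, ‖U x‖ = ‖x‖) (hK : ∀ x ∈ K, ∃ y ∈ K, U y = x) {d : H}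
    (hd : ∃ y ∈ K, U y = d) (hd0 : K.starProjection d = 0) (n : ℕ) :
    ‖opSum U n d‖ = √n * ‖d‖ := by
  have h : ‖opSum U n d‖ ^ 2 = n * ‖d‖ ^ 2 := by
    induction n with
    | zero => simp [opSum]
    | succ n ih =>
      obtain ⟨y, hy, hyd⟩ := exists_pow_apply_eq_opSum hK hd n
      have h0 : inner ℝ (opSum U n d) ((U ^ n) d) = 0 := by
        rw [← hyd, inner_pow_apply hU]
        rw [Submodule.starProjection_apply_eq_zero_iff, Submodule.mem_orthogonal] at hd0
        exact hd0 y hy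
      rw [opSum_succ, add_apply, norm_add_sq_real, h0, ih,
        norm_pow_apply hU]
      push_cast
      ring
  rw [← Real.sqrt_sq (norm_nonneg (opSum U n d)), h, Real.sqrt_mul (by positivity),
    Real.sqrt_sq (norm_nonneg _)]

theorem sum_sqrt_two_pow_le (s : ℕ) : ∑ j ∈ Finset.range s, √2 ^ j ≤ 3 * √2 ^ s := by
  induction s with
  | zero => simp
  | succ s ih =>
    rw [Finset.sum_range_succ, pow_succ]
    -- The induction step amounts to `3 + 1 ≤ 3 √2`.
    have h : (4 / 3 : ℝ) ≤ √2 := Real.le_sqrt_of_sq_le (by norm_num)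
    nlinarith [pow_pos (Real.sqrt_pos.2 (zero_lt_two' ℝ)) s]

/-- The martingale difference attached to the approximate solution of the Poisson equation. -/
noncomputable def approxDiff (K : Submodule ℝ H) [K.HasOrthogonalProjection] (U : H →L[ℝ] H)
    (f : H) (m : ℕ) : H :=
  U (cesaroNeumann (compression K U) m f) -
    K.starProjection (U (cesaroNeumann (compression K U) m f))

/-- Two complementary bounds for the remainder: the first gains for `k` below `m`. In the second,
used from `m` on, the sums of lengths `k` and `m` are exchanged and the average over `m` is absorbed
by contractivity. -/
theorem norm_starProjection_opSum_remainder_le (hU : ∀ x, ‖U x‖ = ‖x‖)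
    (hK : ∀ x ∈ K, ∃ y ∈ K, U y = x) {f : H} (hf : f ∈ K) {m : ℕ} (hm : m ≠ 0) (k : ℕ) :
    ‖K.starProjection (opSum U k
        ((m : ℝ)⁻¹ • compression K U (opSum (compression K U) m f)))‖ ≤
      (m : ℝ)⁻¹ * (k * ‖K.starProjection (opSum U m f)‖) ∧
    ‖K.starProjection (opSum U k
        ((m : ℝ)⁻¹ • compression K U (opSum (compression K U) m f)))‖ ≤
      ‖K.starProjection (opSum U k f)‖ := by
  have hV := norm_compression_apply_le (K := K) hU
  have hm' : (0 : ℝ) < m := by positivity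
  rw [starProjection_opSum_apply hU hK k (K.smul_mem _ (compression_apply_mem _)),
    starProjection_opSum_apply hU hK m hf, starProjection_opSum_apply hU hK k hf]
  set V := compression K U
  rw [map_smul, norm_smul, norm_inv, Real.norm_natCast]
  constructor
  · gcongr
    exact (norm_opSum_apply_le hV k _).trans (by gcongr; exact hV _)
  · have hcomm : opSum V k (V (opSum V m f)) = V (opSum V m (opSum V k f)) := by
      have h1 := congrArg (fun W : H →L[ℝ] H => W (opSum V m f)) (opSum_commute_self V k).eq
      have h2 := congrArg (fun W : H →L[ℝ] H => W f) (opSum_commute V k m).eq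
      simp only [mul_apply_eq_comp] at h1 h2
      rw [← h1, h2]
    rw [hcomm, inv_mul_le_iff₀ hm']
    exact (hV _).trans (norm_opSum_apply_le hV m _)

theorem norm_opSum_sub_approxDiff_le (hU : ∀ x, ‖U x‖ = ‖x‖) (hK : ∀ x ∈ K, ∃ y ∈ K, U y = x)
    {f : H} (hf : f ∈ K) {e : ℝ} {s r : ℕ} (hsr : s ≤ r)
    (h1 : ∀ i ≤ 2 ^ s, ‖K.starProjection (opSum U i f)‖ ≤ √2 ^ s * e)
    (h2 : ∑ j ∈ Finset.Ico s r, (√2 ^ j)⁻¹ * ‖K.starProjection (opSum U (2 ^ j) f)‖ ≤ e) :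
    ‖opSum U (2 ^ r) (f - approxDiff K U f (2 ^ s))‖ ≤ 2 * √2 ^ s * e + √2 ^ r * (3 * e) := by
  have hV := norm_compression_apply_le (K := K) hU
  have hq : ∀ j : ℕ, √2 ^ j * √2 ^ j = 2 ^ j := fun j => by
    rw [← mul_pow, Real.mul_self_sqrt zero_le_two]
  have hq1 : ∀ j : ℕ, 1 ≤ √2 ^ j := fun j => one_le_pow₀ (Real.one_le_sqrt.2 one_le_two)
  have he : 0 ≤ e := le_trans (Finset.sum_nonneg fun j _ => by positivity) h2
  set θ := cesaroNeumann (compression K U) (2 ^ s) f with hθ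
  set h := ((2 ^ s : ℕ) : ℝ)⁻¹ • compression K U (opSum (compression K U) (2 ^ s) f) with hh
  have hhK : h ∈ K := K.smul_mem _ (compression_apply_mem _)
  have hθn : ‖θ‖ ≤ √2 ^ s * e := norm_cesaroNeumann_le _ (by positivity) fun i hi => by
    rw [← starProjection_opSum_apply hU hK i hf]; exact h1 i hi
  -- What is left after removing the martingale difference is the remainder `h` and a coboundary,
  -- whose sums telescope.
  have hdec : f - approxDiff K U f (2 ^ s) = h - (U θ - θ) := by
    have := cesaroNeumann_sub (compression K U) (m := 2 ^ s) (by positivity) f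
    rw [← hθ, ← hh] at this
    have hc : compression K U θ = K.starProjection (U θ) := rfl
    rw [approxDiff, ← hθ, ← hc, this]
    abel
  have hcob : opSum U (2 ^ r) (U θ - θ) = (U ^ (2 ^ r)) θ - θ := by
    have := congrArg (fun W : H →L[ℝ] H => W θ) (geom_sum_mul U (2 ^ r))
    simpa [opSum] using this
  have hrem := fun k => norm_starProjection_opSum_remainder_le hU hK hf
    (m := 2 ^ s) (by positivity) k
  rw [← hh] at hrem
  have hnh : ‖h‖ ≤ e := by
    have := (hrem 1).1
    rw [opSum, Finset.sum_range_one, pow_zero, one_apply_eq_self,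
      K.starProjection_eq_self_iff.2 hhK] at this
    refine this.trans ?_
    rw [inv_mul_le_iff₀ (by positivity)]
    have := h1 _ le_rfl
    push_cast
    rw [one_mul, ← hq, mul_assoc]
    exact this.trans (le_mul_of_one_le_left (by positivity) (hq1 s))
  -- Scales below `s` use the first remainder bound and sum geometrically to `3 e`; the others use
  -- the second bound and `h2`.
  have hsum : ∑ j ∈ Finset.range r, (√2 ^ j)⁻¹ * ‖K.starProjection (opSum U (2 ^ j) h)‖ ≤
      3 * e + e := by
    rw [← Finset.sum_range_add_sum_Ico _ hsr]
    refine add_le_add ?_ (le_trans (Finset.sum_le_sum fun j _ => ?_) h2)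
    · have : ∀ j ∈ Finset.range s,
          (√2 ^ j)⁻¹ * ‖K.starProjection (opSum U (2 ^ j) h)‖ ≤ √2 ^ j * ((√2 ^ s)⁻¹ * e) := by
        intro j _
        rw [inv_mul_le_iff₀ (by positivity)]
        refine (hrem _).1.trans ?_
        rw [inv_mul_le_iff₀ (by positivity), ← mul_assoc (√2 ^ j), hq]
        push_cast
        rw [← hq s]
        have hs := h1 _ le_rfl
        calc (2 : ℝ) ^ j * ‖K.starProjection (opSum U (2 ^ s) f)‖
            ≤ 2 ^ j * (√2 ^ s * e) := by gcongr
          _ = √2 ^ s * √2 ^ s * (2 ^ j * ((√2 ^ s)⁻¹ * e)) := by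
            have : √2 ^ s ≠ 0 := by positivity
            field_simp
      refine (Finset.sum_le_sum this).trans ?_
      rw [← Finset.sum_mul]
      refine (mul_le_mul_of_nonneg_right (sum_sqrt_two_pow_le s) (by positivity)).trans
        (le_of_eq ?_)
      have : √2 ^ s ≠ 0 := by positivity
      field_simp
    · gcongr
      exact (hrem _).2
  rw [hdec, map_sub, hcob]
  have hn := norm_opSum_two_pow_le hU hK hhK r
  have h3 : ‖(U ^ (2 ^ r)) θ - θ‖ ≤ 2 * √2 ^ s * e := by
    refine (norm_sub_le _ _).trans ?_
    rw [norm_pow_apply hU]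
    linarith
  have h4 : √2 ^ r * (‖h‖ + (∑ j ∈ Finset.range r,
      (√2 ^ j)⁻¹ * ‖K.starProjection (opSum U (2 ^ j) h)‖) / 2) ≤ √2 ^ r * (3 * e) := by
    gcongr
    linarith
  linarith [norm_sub_le (opSum U (2 ^ r) h) ((U ^ (2 ^ r)) θ - θ)]

theorem exists_martingaleDiff_approx [CompleteSpace H] (hU : ∀ x, ‖U x‖ = ‖x‖)
    (hK : ∀ x ∈ K, ∃ y ∈ K, U y = x) {f : H} (hf : f ∈ K) {e : ℕ → ℝ}
    (he : Tendsto e atTop (𝓝 0))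
    (h1 : ∀ s, ∀ i ≤ 2 ^ s, ‖K.starProjection (opSum U i f)‖ ≤ √2 ^ s * e s)
    (h2 : ∀ s r, ∑ j ∈ Finset.Ico s r,
      (√2 ^ j)⁻¹ * ‖K.starProjection (opSum U (2 ^ j) f)‖ ≤ e s) :
    ∃ y ∈ K, K.starProjection (U y) = 0 ∧
      ∀ s, ‖opSum U (2 ^ s) f - opSum U (2 ^ s) (U y)‖ ≤ √2 ^ s * (8 * e s) := by
  set D : ℕ → H := fun s => approxDiff K U f (2 ^ s) with hD
  set L : Submodule ℝ H := K.map (U : H →ₗ[ℝ] H) with hL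
  have hD0 : ∀ s, K.starProjection (D s) = 0 := fun s => by
    simp only [hD, approxDiff, map_sub]
    rw [sub_eq_zero, K.starProjection_eq_self_iff.2 (K.starProjection_apply_mem _)]
  have hDL : ∀ s, D s ∈ L := fun s => by
    have hθ : cesaroNeumann (compression K U) (2 ^ s) f ∈ K :=
      K.smul_mem _ (K.sum_mem fun i _ => opSum_compression_mem hf _)
    refine L.sub_mem ⟨_, hθ, rfl⟩ ?_
    obtain ⟨y, hy, h⟩ := hK _ (K.starProjection_apply_mem
      (U (cesaroNeumann (compression K U) (2 ^ s) f)))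
    exact ⟨y, hy, h⟩
  have hR : ∀ s r, s ≤ r → ‖opSum U (2 ^ r) (f - D s)‖ ≤
      2 * √2 ^ s * e s + √2 ^ r * (3 * e s) := fun s r hsr =>
    norm_opSum_sub_approxDiff_le hU hK hf hsr (h1 s) (h2 s r)
  have horth : ∀ d ∈ L, K.starProjection d = 0 → ∀ r : ℕ,
      ‖opSum U (2 ^ r) d‖ = √2 ^ r * ‖d‖ := by
    rintro d ⟨y, hy, hyd⟩ hd r
    rw [norm_opSum_of_orthogonal hU hK ⟨y, hy, hyd⟩ hd]
    congr 1
    rw [Nat.cast_pow, Nat.cast_ofNat, Real.sqrt_eq_iff_mul_self_eq (by positivity) (by positivity),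
      ← mul_pow, Real.mul_self_sqrt zero_le_two]
  -- Both differences approximate the same sums. Dividing by `√2 ^ r` and letting `r → ∞` removes
  -- the coboundary terms, while the norm of the martingale sum scales exactly.
  have hclose : ∀ s t, ‖D s - D t‖ ≤ 3 * (e s + e t) := by
    intro s t
    have hlim : Tendsto (fun r : ℕ => (√2 ^ r)⁻¹ * (2 * √2 ^ s * e s + 2 * √2 ^ t * e t) +
        3 * (e s + e t)) atTop (𝓝 (0 * (2 * √2 ^ s * e s + 2 * √2 ^ t * e t) +
        3 * (e s + e t))) := by
      refine ((tendsto_inv_atTop_zero.comp (tendsto_pow_atTop_atTop_of_one_lt ?_)).mul_const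
        _).add_const _
      exact Real.lt_sqrt_of_sq_lt (by norm_num)
    rw [zero_mul, zero_add] at hlim
    refine ge_of_tendsto hlim ?_
    filter_upwards [eventually_ge_atTop (max s t)] with r hr
    have hs := hR s r (le_of_max_le_left hr)
    have ht := hR t r (le_of_max_le_right hr)
    have hd := horth (D s - D t) (L.sub_mem (hDL s) (hDL t)) (by rw [map_sub, hD0, hD0, sub_zero]) r
    have hpos : 0 < √2 ^ r := by positivity
    have htri : ‖opSum U (2 ^ r) (D s - D t)‖ ≤
        ‖opSum U (2 ^ r) (f - D t)‖ + ‖opSum U (2 ^ r) (f - D s)‖ := by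
      rw [show D s - D t = (f - D t) - (f - D s) by abel, map_sub]
      exact norm_sub_le _ _
    have : √2 ^ r * ‖D s - D t‖ ≤
        √2 ^ r * ((√2 ^ r)⁻¹ * (2 * √2 ^ s * e s + 2 * √2 ^ t * e t) + 3 * (e s + e t)) := by
      rw [mul_add, mul_inv_cancel_left₀ hpos.ne']
      linarith
    exact le_of_mul_le_mul_left this hpos
  have hcauchy : CauchySeq D := by
    rw [Metric.cauchySeq_iff']
    intro ε hε
    obtain ⟨N, hN⟩ := (he.eventually (gt_mem_nhds (show (0 : ℝ) < ε / 6 by positivity))).exists_forall_of_atTop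
    refine ⟨N, fun n hn => ?_⟩
    rw [dist_eq_norm]
    have := hclose n N
    linarith [hN n hn, hN N le_rfl]
  obtain ⟨d, hd⟩ := cauchySeq_tendsto_of_complete hcauchy
  have hKc : IsClosed (K : Set H) := by
    rw [← K.orthogonal_orthogonal]
    exact Kᗮ.isClosed_orthogonal
  have hLc : IsClosed (L : Set H) := by
    have hiso : Isometry U := AddMonoidHomClass.isometry_of_norm U hU
    have := (hiso.isClosedEmbedding).isClosedMap _ hKc
    simpa [hL] using this
  obtain ⟨y, hy, rfl⟩ := hLc.mem_of_tendsto hd (Eventually.of_forall hDL)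
  refine ⟨y, hy, ?_, fun s => ?_⟩
  · refine tendsto_nhds_unique ((K.starProjection.continuous.tendsto _).comp hd) ?_
    simp [Function.comp_def, hD0]
  · have h0 : K.starProjection (U y) = 0 := by
      refine tendsto_nhds_unique ((K.starProjection.continuous.tendsto _).comp hd) ?_
      simp [Function.comp_def, hD0]
    have hlim : ‖D s - U y‖ ≤ 3 * (e s + 0) :=
      le_of_tendsto_of_tendsto (tendsto_const_nhds.sub hd).norm
        ((tendsto_const_nhds.add he).const_mul _) (Eventually.of_forall fun t => hclose s t)
    have h3 := horth (D s - U y) (L.sub_mem (hDL s) ⟨y, hy, rfl⟩)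
      (by rw [map_sub, hD0, h0, sub_zero]) s
    -- At `r = s` the two terms contribute `2 + 3`; the distance from `D s` to the limit contributes
    -- `3` more, whence `8`.
    have h4 := hR s s le_rfl
    rw [← map_sub, show f - U y = (f - D s) + (D s - U y) by abel, map_add]
    have h5 := mul_le_mul_of_nonneg_left hlim (show 0 ≤ √2 ^ s by positivity)
    linarith [norm_add_le (opSum U (2 ^ s) (f - D s)) (opSum U (2 ^ s) (D s - U y))]

end Projection

/-! ### Weighted tail sums at dyadic indices -/

section Sequences

/-- The tail sum `w n + w (n + 1) + ⋯`. -/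
noncomputable def tailSum (w : ℕ → ℝ) (n : ℕ) : ℝ := ∑' k, w (k + n)

variable {w : ℕ → ℝ}

theorem tailSum_nonneg (hw : ∀ k, 0 ≤ w k) (n : ℕ) : 0 ≤ tailSum w n := tsum_nonneg fun _ => hw _

theorem sum_Ico_eq_tailSum_sub (hs : Summable w) {m n : ℕ} (hmn : m ≤ n) :
    ∑ k ∈ Finset.Ico m n, w k = tailSum w m - tailSum w n := by
  have h1 := hs.sum_add_tsum_nat_add m
  have h2 := hs.sum_add_tsum_nat_add n
  rw [Finset.sum_Ico_eq_sub _ hmn, tailSum, tailSum]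
  linarith

theorem tailSum_antitone (hw : ∀ k, 0 ≤ w k) (hs : Summable w) : Antitone (tailSum w) := by
  intro m n hmn
  have := sum_Ico_eq_tailSum_sub hs hmn
  have h0 : 0 ≤ ∑ k ∈ Finset.Ico m n, w k := Finset.sum_nonneg fun _ _ => hw _
  linarith

/-- Averaging `a i ≤ a (i + k) + a k` over `n ≤ k < 2 n` only involves indices in `[n, 4 n)`, where
`k ^ (3 / 2) ≤ 8 n ^ (3 / 2)`. -/
theorem le_sqrt_mul_sum_of_le_add {a : ℕ → ℝ} (ha : ∀ k, 0 ≤ a k)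
    (hsub : ∀ i k, a i ≤ a (i + k) + a k) {i n : ℕ} (hn : 1 ≤ n) (hi : i ≤ n) :
    a i ≤ 16 * √n * ∑ k ∈ Finset.Ico n (4 * n), a k / (k : ℝ) ^ (3 / 2 : ℝ) := by
  have hn0 : (0 : ℝ) < n := by exact_mod_cast hn
  have h1 : (n : ℝ) * a i ≤ 2 * ∑ k ∈ Finset.Ico n (4 * n), a k := by
    calc (n : ℝ) * a i = ∑ k ∈ Finset.Ico n (2 * n), a i := by
          rw [Finset.sum_const, Nat.card_Ico, nsmul_eq_mul, two_mul, Nat.add_sub_cancel]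
      _ ≤ ∑ k ∈ Finset.Ico n (2 * n), (a (i + k) + a k) := Finset.sum_le_sum fun k _ => hsub i k
      _ = ∑ k ∈ Finset.Ico (n + i) (2 * n + i), a k + ∑ k ∈ Finset.Ico n (2 * n), a k := by
          rw [Finset.sum_add_distrib, Finset.sum_Ico_add]
      _ ≤ ∑ k ∈ Finset.Ico n (4 * n), a k + ∑ k ∈ Finset.Ico n (4 * n), a k := by
          refine add_le_add ?_ ?_ <;>
            exact Finset.sum_le_sum_of_subset_of_nonneg
              (Finset.Ico_subset_Ico (by omega) (by omega)) fun _ _ _ => ha _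
      _ = _ := by ring
  have h2 : ∀ k ∈ Finset.Ico n (4 * n), a k ≤ 8 * (n * √n) * (a k / (k : ℝ) ^ (3 / 2 : ℝ)) := by
    intro k hk
    rw [Finset.mem_Ico] at hk
    have hk0 : (0 : ℝ) < k := by exact_mod_cast (by omega : 0 < k)
    have h3 : (k : ℝ) ^ (3 / 2 : ℝ) ≤ 8 * (n * √n) := by
      calc (k : ℝ) ^ (3 / 2 : ℝ) ≤ ((2 : ℝ) ^ (2 : ℝ) * n) ^ (3 / 2 : ℝ) := by
            refine Real.rpow_le_rpow hk0.le ?_ (by norm_num)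
            have : (k : ℝ) < 4 * n := by exact_mod_cast hk.2
            norm_num
            linarith
        _ = 8 * (n * √n) := by
            rw [Real.mul_rpow (by positivity) hn0.le, ← Real.rpow_mul (by norm_num),
              show (3 / 2 : ℝ) = 1 + 1 / 2 by norm_num, Real.rpow_add hn0, Real.rpow_one,
              ← Real.sqrt_eq_rpow]
            norm_num
    rw [mul_div_assoc', le_div_iff₀ (by positivity), mul_comm]
    exact mul_le_mul_of_nonneg_right h3 (ha k)
  have h4 := Finset.sum_le_sum h2
  rw [← Finset.mul_sum] at h4
  refine le_of_mul_le_mul_left ?_ hn0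
  linarith

theorem le_sqrt_two_pow_mul_tailSum {a : ℕ → ℝ} (ha : ∀ k, 0 ≤ a k)
    (hsub : ∀ i k, a i ≤ a (i + k) + a k)
    (hs : Summable fun k : ℕ => a k / (k : ℝ) ^ (3 / 2 : ℝ)) (s i : ℕ) (hi : i ≤ 2 ^ s) :
    a i ≤ √2 ^ s * (16 * (tailSum (fun k : ℕ => a k / (k : ℝ) ^ (3 / 2 : ℝ)) (2 ^ s) -
      tailSum (fun k : ℕ => a k / (k : ℝ) ^ (3 / 2 : ℝ)) (2 ^ (s + 2)))) := by
  have h := le_sqrt_mul_sum_of_le_add ha hsub Nat.one_le_two_pow hi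
  rw [sum_Ico_eq_tailSum_sub hs (by omega), show 4 * 2 ^ s = 2 ^ (s + 2) by ring,
    show √((2 ^ s : ℕ) : ℝ) = √2 ^ s by
      rw [Nat.cast_pow, Nat.cast_ofNat, Real.sqrt_eq_iff_mul_self_eq (by positivity)
        (by positivity), ← mul_pow, Real.mul_self_sqrt zero_le_two]] at h
  linarith

/-- Each term is at most `16 (F j - F (j + 2))`, with `F` the tail at `2 ^ j`, and these telescope
to at most `16 (F s + F (s + 1))`. -/
theorem sum_Ico_inv_sqrt_two_pow_mul_le {a : ℕ → ℝ} (ha : ∀ k, 0 ≤ a k)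
    (hsub : ∀ i k, a i ≤ a (i + k) + a k)
    (hs : Summable fun k : ℕ => a k / (k : ℝ) ^ (3 / 2 : ℝ)) (s r : ℕ) :
    ∑ j ∈ Finset.Ico s r, (√2 ^ j)⁻¹ * a (2 ^ j) ≤
      32 * tailSum (fun k : ℕ => a k / (k : ℝ) ^ (3 / 2 : ℝ)) (2 ^ s) := by
  have hw : ∀ k : ℕ, 0 ≤ a k / (k : ℝ) ^ (3 / 2 : ℝ) := fun k =>
    div_nonneg (ha k) (by positivity)
  set F : ℕ → ℝ := fun j => tailSum (fun k : ℕ => a k / (k : ℝ) ^ (3 / 2 : ℝ)) (2 ^ j) with hF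
  have hF0 : ∀ j, 0 ≤ F j := fun j => tailSum_nonneg hw _
  have hF1 : F (s + 1) ≤ F s := tailSum_antitone hw hs (Nat.pow_le_pow_right two_pos (by omega))
  have h1 : ∀ j, (√2 ^ j)⁻¹ * a (2 ^ j) ≤
      16 * (F j + F (j + 1)) - 16 * (F (j + 1) + F (j + 1 + 1)) := by
    intro j
    rw [inv_mul_le_iff₀ (by positivity)]
    refine (le_sqrt_two_pow_mul_tailSum ha hsub hs j _ le_rfl).trans (le_of_eq ?_)
    simp only [hF]
    ring
  refine (Finset.sum_le_sum fun j _ => h1 j).trans ?_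
  rw [Finset.sum_Ico_eq_sum_range]
  have h2 := Finset.sum_range_sub' (fun j => 16 * (F (s + j) + F (s + j + 1))) (r - s)
  simp only [← add_assoc, add_zero] at h2
  rw [h2]
  linarith [hF0 (s + (r - s)), hF0 (s + (r - s) + 1)]

/-- Cauchy condensation: on `[2 ^ r, 2 ^ (r + 1))` the summand is at least a constant times `r 2⁻ʳ`
times the squared tail at the right end. -/
theorem summable_mul_tailSum_two_pow (hw : ∀ k, 0 ≤ w k) (hs : Summable w)
    (hlog : Summable fun n : ℕ => Real.log n / n * tailSum w n ^ 2) :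
    Summable fun j : ℕ => ((j : ℝ) + 1) * tailSum w (2 ^ j) ^ 2 := by
  set u : ℕ → ℝ := fun n => Real.log n / n * tailSum w n ^ 2 with hu
  have hu0 : ∀ n, 0 ≤ u n := fun n =>
    mul_nonneg (div_nonneg (Real.log_natCast_nonneg n) (by positivity)) (by positivity)
  have hlog2 : 0 < Real.log 2 := Real.log_pos one_lt_two
  have hblock : ∀ r : ℕ, (r : ℝ) * tailSum w (2 ^ (r + 1)) ^ 2 ≤
      2 / Real.log 2 * (tailSum u (2 ^ r) - tailSum u (2 ^ (r + 1))) := by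
    intro r
    rw [← sum_Ico_eq_tailSum_sub hlog (Nat.pow_le_pow_right two_pos (by omega))]
    have hterm : ∀ n ∈ Finset.Ico (2 ^ r) (2 ^ (r + 1)),
        (r * Real.log 2) / 2 ^ (r + 1) * tailSum w (2 ^ (r + 1)) ^ 2 ≤ u n := by
      intro n hn
      rw [Finset.mem_Ico] at hn
      have hn0 : 0 < n := lt_of_lt_of_le (by positivity) hn.1
      have h1 : (r : ℝ) * Real.log 2 ≤ Real.log n := by
        rw [← Real.log_pow]
        exact Real.log_le_log (by positivity) (by exact_mod_cast hn.1)
      have h2 : (n : ℝ) ≤ 2 ^ (r + 1) := by exact_mod_cast hn.2.le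
      have h3 : tailSum w (2 ^ (r + 1)) ≤ tailSum w n := tailSum_antitone hw hs hn.2.le
      have h4 := tailSum_nonneg hw (2 ^ (r + 1))
      have h5 := Real.log_natCast_nonneg n
      simp only [hu]
      gcongr
    have := Finset.card_nsmul_le_sum _ _ _ hterm
    rw [Nat.card_Ico, pow_succ, mul_two, Nat.add_sub_cancel, nsmul_eq_mul, Nat.cast_pow] at this
    rw [← mul_two (2 ^ r), ← pow_succ] at this
    have h6 : (r : ℝ) * tailSum w (2 ^ (r + 1)) ^ 2 = 2 / Real.log 2 *
        (((2 : ℕ) : ℝ) ^ r * (r * Real.log 2 / 2 ^ (r + 1) * tailSum w (2 ^ (r + 1)) ^ 2)) := by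
      push_cast
      field_simp
      ring
    rw [h6]
    gcongr
  have hsum : Summable fun r : ℕ => (r : ℝ) * tailSum w (2 ^ (r + 1)) ^ 2 := by
    refine summable_of_sum_range_le (c := 2 / Real.log 2 * tailSum u 1)
      (fun r => by positivity) fun R => ?_
    refine (Finset.sum_le_sum fun r _ => hblock r).trans ?_
    rw [← Finset.mul_sum, Finset.sum_range_sub' (fun r => tailSum u (2 ^ r)) R, pow_zero]
    gcongr
    linarith [tailSum_nonneg hu0 (2 ^ R)]
  -- The block bound is empty for `r = 0`; two steps further on, `j + 3 ≤ 4 (j + 1)` compares the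
  -- weights.
  refine (summable_nat_add_iff 2).1 (Summable.of_nonneg_of_le (fun j => by positivity)
    (fun j => ?_) (((summable_nat_add_iff 1).2 hsum).mul_left 4))
  push_cast
  rw [← mul_assoc]
  gcongr
  linarith [(Nat.cast_nonneg j : (0 : ℝ) ≤ j)]

/-- The equivalence between `ℕ` and the integers that are at least `n`. -/
def natEquivIci (n : ℕ) : ℕ ≃ Set.Ici n where
  toFun k := ⟨k + n, Nat.le_add_left n k⟩
  invFun k := k - n
  left_inv k := by simp
  right_inv k := Subtype.ext (Nat.sub_add_cancel k.2)

theorem tsum_Ici_eq_tsum_add (g : ℕ → ENNReal) (n : ℕ) :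
    ∑' k : Set.Ici n, g k = ∑' k, g (k + n) :=
  ((natEquivIci n).tsum_eq fun k : Set.Ici n => g k).symm

theorem summable_of_tsum_Ici_lt_top {a : ℕ → ℝ} (ha : ∀ k, 0 ≤ a k)
    (h : ∑' n : Set.Ici (1 : ℕ), ENNReal.ofReal (Real.log (n : ℕ) / (n : ℕ)) *
      (∑' k : Set.Ici (n : ℕ),
        ENNReal.ofReal (a k) / ((k : ℕ) : ENNReal) ^ (3 / 2 : ℝ)) ^ 2 < ⊤) :
    (Summable fun k : ℕ => a k / (k : ℝ) ^ (3 / 2 : ℝ)) ∧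
    Summable fun n : ℕ => Real.log n / n *
      tailSum (fun k : ℕ => a k / (k : ℝ) ^ (3 / 2 : ℝ)) n ^ 2 := by
  set w : ℕ → ℝ := fun k => a k / (k : ℝ) ^ (3 / 2 : ℝ) with hw
  have hw0 : ∀ k, 0 ≤ w k := fun k => div_nonneg (ha k) (by positivity)
  have hterm : ∀ k : ℕ, 1 ≤ k →
      ENNReal.ofReal (a k) / (k : ENNReal) ^ (3 / 2 : ℝ) = ENNReal.ofReal (w k) := by
    intro k hk
    have hk0 : (0 : ℝ) < k := by exact_mod_cast hk
    rw [hw, ENNReal.ofReal_div_of_pos (by positivity), ← ENNReal.ofReal_natCast,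
      ENNReal.ofReal_rpow_of_pos hk0]
  have hinner : ∀ n : ℕ, 1 ≤ n → ∑' k : Set.Ici n,
      ENNReal.ofReal (a k) / ((k : ℕ) : ENNReal) ^ (3 / 2 : ℝ) =
        ∑' k, ENNReal.ofReal (w (k + n)) := by
    intro n hn
    rw [tsum_Ici_eq_tsum_add (fun k : ℕ => ENNReal.ofReal (a k) / (k : ENNReal) ^ (3 / 2 : ℝ))]
    exact tsum_congr fun k => hterm _ (by omega)
  rw [tsum_Ici_eq_tsum_add (fun n : ℕ => ENNReal.ofReal (Real.log n / n) *
      (∑' k : Set.Ici n, ENNReal.ofReal (a k) / ((k : ℕ) : ENNReal) ^ (3 / 2 : ℝ)) ^ 2)] at h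
  have hs : Summable w := by
    have h2 := (ENNReal.ne_top_of_tsum_ne_top h.ne 1)
    rw [hinner _ (by norm_num)] at h2
    -- The term `n = 1` has weight `log 1 = 0`, so finiteness of the inner series is read off from
    -- `n = 2`.
    have hpos : ENNReal.ofReal (Real.log (1 + 1 : ℕ) / (1 + 1 : ℕ)) ≠ 0 := by
      rw [ENNReal.ofReal_ne_zero_iff]
      exact div_pos (Real.log_pos (by norm_num)) (by norm_num)
    have h3 : ∑' k, ENNReal.ofReal (w (k + (1 + 1))) ≠ ⊤ := by
      intro htop
      rw [htop] at h2
      exact h2 (by rw [ENNReal.top_pow two_ne_zero, ENNReal.mul_top hpos])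
    refine (summable_nat_add_iff (1 + 1)).1 ?_
    have := ENNReal.summable_toReal h3
    simpa [ENNReal.toReal_ofReal (hw0 _)] using this
  refine ⟨hs, (summable_nat_add_iff 1).1 ?_⟩
  have := ENNReal.summable_toReal h.ne
  refine this.congr fun n => ?_
  rw [hinner _ (by omega), ← ENNReal.ofReal_tsum_of_nonneg (fun k => hw0 _)
    ((summable_nat_add_iff (n + 1)).2 hs), ENNReal.toReal_mul, ENNReal.toReal_pow,
    ENNReal.toReal_ofReal (div_nonneg (Real.log_natCast_nonneg _) (by positivity)),
    ENNReal.toReal_ofReal (tsum_nonneg fun k => hw0 _)]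
  rfl

end Sequences

/-! ### The maximal ergodic inequality -/

section MaximalErgodic

variable {Ω : Type*} {mΩ : MeasurableSpace Ω} {μ : Measure Ω} {T : Ω → Ω}

/-- The maximum of the Birkhoff sums of `f` of length at most `N`. -/
noncomputable def birkhoffMax (T : Ω → Ω) (f : Ω → ℝ) : ℕ → Ω → ℝ
  | 0 => 0
  | N + 1 => fun ω => max 0 (f ω + birkhoffMax T f N (T ω))

variable {f : Ω → ℝ}

theorem birkhoffMax_nonneg (N : ℕ) (ω : Ω) : 0 ≤ birkhoffMax T f N ω := by
  cases N with
  | zero => exact le_rfl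
  | succ N => exact le_max_left _ _

theorem birkhoffMax_le_succ (N : ℕ) (ω : Ω) :
    birkhoffMax T f N ω ≤ birkhoffMax T f (N + 1) ω := by
  induction N generalizing ω with
  | zero => exact birkhoffMax_nonneg _ _
  | succ N ih => exact max_le_max le_rfl (by gcongr; exact ih _)

theorem birkhoffSum_le_birkhoffMax {n N : ℕ} (h : n ≤ N) (ω : Ω) :
    birkhoffSum T f n ω ≤ birkhoffMax T f N ω := by
  induction N generalizing n ω with
  | zero => obtain rfl : n = 0 := by omega
            simp [birkhoffMax]
  | succ N ih =>
    cases n with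
    | zero => simpa using birkhoffMax_nonneg (N + 1) ω
    | succ n =>
      rw [birkhoffSum_succ']
      exact le_max_of_le_right (by gcongr; exact ih (by omega) _)

theorem birkhoffMax_le_of_pos {N : ℕ} {ω : Ω} (h : 0 < birkhoffMax T f N ω) :
    birkhoffMax T f N ω ≤ f ω + birkhoffMax T f N (T ω) := by
  cases N with
  | zero => exact absurd h (lt_irrefl _)
  | succ N =>
    have h1 : birkhoffMax T f (N + 1) ω = max 0 (f ω + birkhoffMax T f N (T ω)) := rfl
    rw [h1] at h ⊢
    rcases lt_max_iff.1 h with h | h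
    · exact absurd h (lt_irrefl _)
    · rw [max_eq_right h.le]
      gcongr
      exact birkhoffMax_le_succ _ _

theorem integrable_birkhoffMax (hT : MeasurePreserving T μ μ) (hf : Integrable f μ) (N : ℕ) :
    Integrable (birkhoffMax T f N) μ := by
  induction N with
  | zero => exact integrable_zero _ _ _
  | succ N ih =>
    exact (integrable_zero _ _ _).sup (hf.add (hT.integrable_comp_of_integrable ih))

/-- The maximal ergodic inequality. -/
theorem measure_exists_lt_birkhoffSum_le [IsFiniteMeasure μ] (hT : MeasurePreserving T μ μ)
    {g : Ω → ℝ} (hg : Integrable g μ) (hg0 : ∀ ω, 0 ≤ g ω) {c : ℝ} (hc : 0 < c) :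
    μ {ω | ∃ n : ℕ, n * c < birkhoffSum T g n ω} ≤ ENNReal.ofReal ((∫ ω, g ω ∂μ) / c) := by
  set f : Ω → ℝ := fun ω => g ω - c with hf
  have hfi : Integrable f μ := hg.sub (integrable_const c)
  have hsum : ∀ (n : ℕ) ω, birkhoffSum T f n ω = birkhoffSum T g n ω - n * c := by
    intro n ω
    simp [birkhoffSum, hf]
  have hbound : ∀ N, μ {ω | 0 < birkhoffMax T f N ω} ≤
      ENNReal.ofReal ((∫ ω, g ω ∂μ) / c) := by
    intro N
    set M := birkhoffMax T f N with hM
    have hMi : Integrable M μ := integrable_birkhoffMax hT hfi N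
    have hMTi : Integrable (fun ω => M (T ω)) μ := hT.integrable_comp_of_integrable hMi
    -- Garsia's argument: `h` has the same integral as `g` by invariance, is nonnegative, and is at
    -- least `c` where `M > 0`, so Markov's inequality concludes.
    set h : Ω → ℝ := fun ω => M (T ω) - M ω + g ω with hh
    have hpos : ∀ ω, 0 < M ω → c ≤ h ω := by
      intro ω hω
      have := birkhoffMax_le_of_pos hω
      simp only [hf] at this
      simp only [hh, hM]
      linarith
    have h0 : ∀ ω, 0 ≤ h ω := by
      intro ω
      rcases (birkhoffMax_nonneg (T := T) (f := f) N ω).eq_or_lt with h1 | h1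
      · have := birkhoffMax_nonneg (T := T) (f := f) N (T ω)
        simp only [hh, hM, ← h1]
        linarith [hg0 ω]
      · exact hc.le.trans (hpos ω h1)
    have hint : ∫ ω, h ω ∂μ = ∫ ω, g ω ∂μ := by
      have hTM : ∫ ω, M (T ω) ∂μ = ∫ ω, M ω ∂μ := by
        have := integral_map (μ := μ) hT.measurable.aemeasurable
          (f := M) (by rw [hT.map_eq]; exact hMi.aestronglyMeasurable)
        rw [hT.map_eq] at this
        exact this.symm
      have h1 : ∫ ω, h ω ∂μ = ∫ ω, (M (T ω) - M ω) ∂μ + ∫ ω, g ω ∂μ :=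
        integral_add (hMTi.sub hMi) hg
      rw [h1, integral_sub hMTi hMi, hTM, sub_self, zero_add]
    have hmarkov := mul_meas_ge_le_integral_of_nonneg (Eventually.of_forall h0)
      ((hMTi.sub hMi).add hg) c
    rw [hint] at hmarkov
    calc μ {ω | 0 < M ω} ≤ μ {ω | c ≤ h ω} := measure_mono fun ω hω => hpos ω hω
      _ = ENNReal.ofReal (μ.real {ω | c ≤ h ω}) := by
        rw [Measure.real, ENNReal.ofReal_toReal (measure_ne_top _ _)]
      _ ≤ _ := ENNReal.ofReal_le_ofReal ((le_div_iff₀' hc).2 hmarkov)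
  have hmono : Monotone fun N => {ω | 0 < birkhoffMax T f N ω} :=
    monotone_nat_of_le_succ fun N ω hω => lt_of_lt_of_le hω (birkhoffMax_le_succ N ω)
  have hsub : {ω | ∃ n : ℕ, n * c < birkhoffSum T g n ω} ⊆
      ⋃ N, {ω | 0 < birkhoffMax T f N ω} := by
    rintro ω ⟨n, hn⟩
    refine Set.mem_iUnion.2 ⟨n, lt_of_lt_of_le ?_ (birkhoffSum_le_birkhoffMax le_rfl ω)⟩
    rw [hsum]
    linarith
  refine (measure_mono hsub).trans ?_
  rw [hmono.measure_iUnion]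
  exact iSup_le hbound

/-- A point at which every `m` fails lies in all the exceptional sets of the maximal inequality,
whose measures tend to `0`. -/
theorem ae_exists_birkhoffSum_le [IsFiniteMeasure μ] (hT : MeasurePreserving T μ μ)
    {g : ℕ → Ω → ℝ} (hg : ∀ m, Integrable (g m) μ) (hg0 : ∀ m ω, 0 ≤ g m ω) {c : ℕ → ℝ}
    (hc : ∀ m, 0 < c m) (hlim : Tendsto (fun m => (∫ ω, g m ω ∂μ) / c m) atTop (𝓝 0)) :
    ∀ᵐ ω ∂μ, ∃ m, ∀ n : ℕ, birkhoffSum T (g m) n ω ≤ n * c m := by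
  rw [ae_iff]
  have h1 : Tendsto (fun m => ENNReal.ofReal ((∫ ω, g m ω ∂μ) / c m)) atTop (𝓝 0) := by
    simpa using ENNReal.tendsto_ofReal hlim
  refine le_antisymm (ge_of_tendsto' h1 fun m => ?_) zero_le
  refine le_trans (measure_mono fun ω hω => ?_)
    (measure_exists_lt_birkhoffSum_le hT (hg m) (hg0 m) (hc m))
  simp only [Set.mem_ofPred_eq, not_exists, not_forall, not_le] at hω
  exact hω m

end MaximalErgodic

/-! ### Dyadic chaining through block averages -/

section Chaining

/-- The average of `x` over the `2 ^ r` consecutive integers from `a` on. -/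
noncomputable def blockAvg (x : ℕ → ℝ) (r a : ℕ) : ℝ :=
  (2 ^ r)⁻¹ * ∑ i ∈ Finset.range (2 ^ r), x (a + i)

theorem blockAvg_succ (x : ℕ → ℝ) (r a : ℕ) :
    blockAvg x (r + 1) a = (blockAvg x r a + blockAvg x r (a + 2 ^ r)) / 2 := by
  rw [blockAvg, blockAvg, blockAvg, show (2 : ℕ) ^ (r + 1) = 2 ^ r + 2 ^ r by ring,
    Finset.sum_range_add, pow_succ]
  simp only [add_assoc]
  field_simp

/-- Cauchy–Schwarz over the block. Enlarging the sum to all `i < N` makes the bound independent of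
`a`, so one bound serves every block of a level. -/
theorem abs_blockAvg_sub_le (x : ℕ → ℝ) {r a N : ℕ} (h : a + 2 ^ r ≤ N) :
    |blockAvg x r (a + 2 ^ r) - blockAvg x r a| ≤
      √((2 ^ r)⁻¹ * ∑ i ∈ Finset.range N, (x (i + 2 ^ r) - x i) ^ 2) := by
  refine Real.abs_le_sqrt ?_
  have h1 : blockAvg x r (a + 2 ^ r) - blockAvg x r a =
      (2 ^ r)⁻¹ * ∑ i ∈ Finset.range (2 ^ r), (x (a + i + 2 ^ r) - x (a + i)) := by
    rw [blockAvg, blockAvg, ← mul_sub, ← Finset.sum_sub_distrib]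
    simp only [add_right_comm]
  have h2 := sq_sum_le_card_mul_sum_sq (s := Finset.range (2 ^ r))
    (f := fun i => x (a + i + 2 ^ r) - x (a + i))
  rw [Finset.card_range] at h2
  push_cast at h2
  have h3 : ∑ i ∈ Finset.range (2 ^ r), (x (a + i + 2 ^ r) - x (a + i)) ^ 2 ≤
      ∑ i ∈ Finset.range N, (x (i + 2 ^ r) - x i) ^ 2 := by
    have h4 := Finset.sum_Ico_eq_sum_range (fun i => (x (i + 2 ^ r) - x i) ^ 2) a (a + 2 ^ r)
    rw [Nat.add_sub_cancel_left] at h4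
    rw [← h4]
    refine Finset.sum_le_sum_of_subset_of_nonneg (fun i hi => ?_) fun _ _ _ => sq_nonneg _
    rw [Finset.mem_Ico] at hi
    exact Finset.mem_range.2 (by omega)
  rw [h1, mul_pow]
  calc ((2 : ℝ) ^ r)⁻¹ ^ 2 * (∑ i ∈ Finset.range (2 ^ r), (x (a + i + 2 ^ r) - x (a + i))) ^ 2
      ≤ ((2 : ℝ) ^ r)⁻¹ ^ 2 * (2 ^ r * ∑ i ∈ Finset.range N, (x (i + 2 ^ r) - x i) ^ 2) := by
        gcongr
        exact h2.trans (by gcongr)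
    _ = _ := by field_simp

/-- Descend to the half block containing `k`: its average differs from that of the whole block by
half the difference of the two halves. -/
theorem abs_sub_blockAvg_le (x : ℕ → ℝ) {N : ℕ} (r a k : ℕ) (hak : a ≤ k) (hk : k < a + 2 ^ r)
    (hN : a + 2 ^ r ≤ N) :
    |x k - blockAvg x r a| ≤
      (∑ j ∈ Finset.range r, √((2 ^ j)⁻¹ * ∑ i ∈ Finset.range N, (x (i + 2 ^ j) - x i) ^ 2)) / 2 := by
  induction r generalizing a with
  | zero =>
    obtain rfl : k = a := by simp at hk; omega
    simp [blockAvg]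
  | succ r ih =>
    rw [pow_succ] at hk hN
    have h := abs_le.1 (abs_blockAvg_sub_le x (r := r) (a := a) (N := N) (by omega))
    rw [Finset.sum_range_succ, blockAvg_succ]
    rcases lt_or_ge k (a + 2 ^ r) with hlt | hge
    · have := abs_le.1 (ih a hak hlt (by omega))
      exact abs_le.2 ⟨by linarith [this.1, h.1, h.2], by linarith [this.2, h.1, h.2]⟩
    · have := abs_le.1 (ih (a + 2 ^ r) hge (by omega) (by omega))
      exact abs_le.2 ⟨by linarith [this.1, h.1, h.2], by linarith [this.2, h.1, h.2]⟩

/-- Dyadic chaining with increments averaged over all starting points. -/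
theorem abs_sub_le_sum_sqrt (x : ℕ → ℝ) {r k : ℕ} (hk : k < 2 ^ r) :
    |x k - x 0| ≤ ∑ j ∈ Finset.range r,
      √((2 ^ j)⁻¹ * ∑ i ∈ Finset.range (2 ^ r), (x (i + 2 ^ j) - x i) ^ 2) := by
  have h1 := abs_sub_blockAvg_le x r 0 k (Nat.zero_le _) (by omega) (N := 2 ^ r) (by omega)
  have h2 := abs_sub_blockAvg_le x r 0 0 le_rfl (by positivity) (N := 2 ^ r) (by omega)
  rw [abs_sub_comm] at h2
  linarith [abs_sub_le (x k) (blockAvg x r 0) (x 0)]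

end Chaining

/-! ### From dyadic bounds to the iterated logarithm -/

section IteratedLog

theorem tendsto_div_sqrt_mul_log₂ {x : ℕ → ℝ}
    (h : ∀ ε > 0, ∃ B ≥ 0, ∀ r k : ℕ, k < 2 ^ r → |x k| ≤ √(2 ^ r) * (B + ε * √(1 + Real.log r))) :
    Tendsto (fun n : ℕ => x n / √((n : ℝ) * log₂ (n : ℝ))) atTop (𝓝 0) := by
  have hlog : Tendsto (fun n : ℕ => Real.log n) atTop atTop :=
    Real.tendsto_log_atTop.comp tendsto_natCast_atTop_atTop
  have hloglog : Tendsto (fun n : ℕ => Real.log (Real.log n)) atTop atTop :=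
    Real.tendsto_log_atTop.comp hlog
  rw [Metric.tendsto_atTop']
  suffices h' : ∀ ε > 0, ∀ᶠ n : ℕ in atTop, |x n / √((n : ℝ) * log₂ (n : ℝ))| ≤ 3 * ε by
    intro ε hε
    obtain ⟨N, hN⟩ := (h' (ε / 4) (by positivity)).exists_forall_of_atTop
    refine ⟨N, fun n hn => ?_⟩
    rw [Real.dist_eq, sub_zero]
    linarith [hN n hn.le]
  intro ε hε
  obtain ⟨B, hB0, hB⟩ := h ε hε
  filter_upwards [hlog.eventually_ge_atTop 1, hloglog.eventually_ge_atTop 3,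
    hloglog.eventually_ge_atTop (2 * (B / ε) ^ 2), eventually_ge_atTop 3] with n h1 h3 hBn hn
  have hn0 : (0 : ℝ) < n := by positivity
  have hL : log₂ (n : ℝ) = Real.log (Real.log n) := by
    rw [log₂, max_eq_right]
    rwa [Real.le_log_iff_exp_le hn0] at h1
  set L := Real.log (Real.log n) with hLdef
  have hr : n < 2 ^ (Nat.log 2 n + 1) := Nat.lt_pow_succ_log_self one_lt_two n
  have hr' : 2 ^ (Nat.log 2 n) ≤ n := Nat.pow_log_le_self 2 (by omega)
  set r := Nat.log 2 n + 1 with hrdef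
  have hpow : (2 : ℝ) ^ r ≤ 2 * n := by
    have : (2 : ℝ) ^ (Nat.log 2 n) ≤ n := by exact_mod_cast hr'
    rw [hrdef, pow_succ]
    linarith
  -- As `r` is at most `3 log n ≤ e² log n`, `log r ≤ 2 + L`, and `L ≥ 3` absorbs the constants.
  have hlogr : 1 + Real.log r ≤ 2 * L := by
    have hr3 : (r : ℝ) ≤ Real.exp 2 * Real.log n := by
      have h5 : (Nat.log 2 n : ℝ) * Real.log 2 ≤ Real.log n := by
        rw [← Real.log_pow]
        exact Real.log_le_log (by positivity) (by exact_mod_cast hr')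
      have h6 : (r : ℝ) = Nat.log 2 n + 1 := by rw [hrdef]; push_cast; ring
      have h7 : (3 : ℝ) ≤ Real.exp 2 := by linarith [Real.add_one_le_exp (2 : ℝ)]
      have h8 : (1 / 2 : ℝ) ≤ Real.log 2 := by linarith [Real.log_two_gt_d9]
      have h9 : (Nat.log 2 n : ℝ) * (1 / 2) ≤ Real.log n :=
        le_trans (by gcongr) h5
      nlinarith
    have h5 : Real.log r ≤ 2 + L := by
      have hr0 : (0 : ℝ) < r := by rw [hrdef]; positivity
      have := Real.log_le_log hr0 hr3
      rwa [Real.log_mul (Real.exp_pos _).ne' (by linarith), Real.log_exp] at this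
    linarith
  have hx := hB r n hr
  rw [abs_div, abs_of_nonneg (Real.sqrt_nonneg _), hL,
    div_le_iff₀ (Real.sqrt_pos.2 (by positivity)), Real.sqrt_mul hn0.le]
  have hs2 : √(2 * (n : ℝ)) = √2 * √n := Real.sqrt_mul (by norm_num) _
  have hs3 : √(2 * L) = √2 * √L := Real.sqrt_mul (by norm_num) _
  have hBL : √2 * B ≤ ε * √L := by
    have : √2 * (B / ε) ≤ √L := by
      refine Real.le_sqrt_of_sq_le ?_
      rw [mul_pow, Real.sq_sqrt (by norm_num)]
      exact hBn
    calc √2 * B = ε * (√2 * (B / ε)) := by field_simp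
      _ ≤ _ := by gcongr
  calc |x n| ≤ √(2 ^ r) * (B + ε * √(1 + Real.log r)) := hx
    _ ≤ √(2 * n) * (B + ε * √(2 * L)) := by gcongr
    _ = √n * (√2 * B + ε * (√2 * √2) * √L) := by rw [hs2, hs3]; ring
    _ ≤ √n * (ε * √L + ε * (√2 * √2) * √L) := by gcongr
    _ = 3 * ε * (√n * √L) := by rw [Real.mul_self_sqrt (by norm_num)]; ring

end IteratedLog

/-! ### Almost sure growth of Birkhoff sums -/

section DyadicSums

variable {Ω : Type*} {mΩ : MeasurableSpace Ω} {μ : Measure Ω} {T : Ω → Ω} {Y : Ω → ℝ}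

theorem memLp_birkhoffSum (hT : MeasurePreserving T μ μ) (hY : MemLp Y 2 μ) (n : ℕ) :
    MemLp (birkhoffSum T Y n) 2 μ := by
  have h := memLp_finsetSum (Finset.range n) fun k (_ : k ∈ Finset.range n) =>
    hY.comp_measurePreserving (hT.iterate k)
  exact h

/-- The normalized square `(j + 1) 2⁻ʲ (Y + ⋯ + Y ∘ T ^ (2ʲ - 1))²`. -/
noncomputable def dyadicSq (T : Ω → Ω) (Y : Ω → ℝ) (j : ℕ) (ω : Ω) : ℝ :=
  ((j : ℝ) + 1) * (2 ^ j)⁻¹ * birkhoffSum T Y (2 ^ j) ω ^ 2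

theorem dyadicSq_nonneg (j : ℕ) (ω : Ω) : 0 ≤ dyadicSq T Y j ω := by
  unfold dyadicSq; positivity

theorem integrable_dyadicSq (hT : MeasurePreserving T μ μ) (hY : MemLp Y 2 μ) (j : ℕ) :
    Integrable (dyadicSq T Y j) μ :=
  (memLp_birkhoffSum hT hY _).integrable_sq.const_mul _

/-- The sum of the normalized squares from rank `J` on. -/
noncomputable def dyadicTail (T : Ω → Ω) (Y : Ω → ℝ) (J : ℕ) (ω : Ω) : ENNReal :=
  ∑' j, ENNReal.ofReal (dyadicSq T Y (j + J) ω)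

theorem lintegral_dyadicTail (hT : MeasurePreserving T μ μ) (hY : MemLp Y 2 μ)
    (hs : Summable fun j => ∫ ω, dyadicSq T Y j ω ∂μ) (J : ℕ) :
    ∫⁻ ω, dyadicTail T Y J ω ∂μ =
      ENNReal.ofReal (tailSum (fun j => ∫ ω, dyadicSq T Y j ω ∂μ) J) := by
  unfold dyadicTail
  rw [lintegral_tsum fun j => (integrable_dyadicSq hT hY _).aemeasurable.ennreal_ofReal, tailSum,
    ENNReal.ofReal_tsum_of_nonneg (fun j => integral_nonneg fun ω => dyadicSq_nonneg _ ω)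
      ((summable_nat_add_iff J).2 hs)]
  exact tsum_congr fun j => (ofReal_integral_eq_lintegral_ofReal (integrable_dyadicSq hT hY _)
    (Eventually.of_forall fun ω => dyadicSq_nonneg _ ω)).symm

theorem aemeasurable_dyadicTail (hT : MeasurePreserving T μ μ) (hY : MemLp Y 2 μ) (J : ℕ) :
    AEMeasurable (dyadicTail T Y J) μ :=
  AEMeasurable.tsum fun _ => (integrable_dyadicSq hT hY _).aemeasurable.ennreal_ofReal

theorem ae_dyadicTail_lt_top (hT : MeasurePreserving T μ μ) (hY : MemLp Y 2 μ)
    (hs : Summable fun j => ∫ ω, dyadicSq T Y j ω ∂μ) (J : ℕ) :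
    ∀ᵐ ω ∂μ, dyadicTail T Y J ω < ⊤ :=
  ae_lt_top' (aemeasurable_dyadicTail hT hY J)
    (by rw [lintegral_dyadicTail hT hY hs]; exact ENNReal.ofReal_ne_top)

theorem integrable_toReal_dyadicTail (hT : MeasurePreserving T μ μ) (hY : MemLp Y 2 μ)
    (hs : Summable fun j => ∫ ω, dyadicSq T Y j ω ∂μ) (J : ℕ) :
    Integrable (fun ω => (dyadicTail T Y J ω).toReal) μ :=
  integrable_toReal_of_lintegral_ne_top (aemeasurable_dyadicTail hT hY J)
    (by rw [lintegral_dyadicTail hT hY hs]; exact ENNReal.ofReal_ne_top)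

theorem integral_toReal_dyadicTail (hT : MeasurePreserving T μ μ) (hY : MemLp Y 2 μ)
    (hs : Summable fun j => ∫ ω, dyadicSq T Y j ω ∂μ) (J : ℕ) :
    ∫ ω, (dyadicTail T Y J ω).toReal ∂μ = tailSum (fun j => ∫ ω, dyadicSq T Y j ω ∂μ) J := by
  rw [integral_toReal (aemeasurable_dyadicTail hT hY J) (ae_dyadicTail_lt_top hT hY hs J),
    lintegral_dyadicTail hT hY hs, ENNReal.toReal_ofReal
      (tailSum_nonneg (fun j => integral_nonneg fun ω => dyadicSq_nonneg _ ω) J)]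

theorem sum_Ico_dyadicSq_le {ω : Ω} {J : ℕ} (h : dyadicTail T Y J ω < ⊤) (r : ℕ) :
    ∑ j ∈ Finset.Ico J r, dyadicSq T Y j ω ≤ (dyadicTail T Y J ω).toReal := by
  have h1 := ENNReal.summable_toReal h.ne
  simp only [ENNReal.toReal_ofReal (dyadicSq_nonneg _ _)] at h1
  rw [Finset.sum_Ico_eq_sum_range, dyadicTail, ENNReal.tsum_toReal_eq fun _ => ENNReal.ofReal_ne_top]
  simp only [ENNReal.toReal_ofReal (dyadicSq_nonneg _ _), add_comm J]
  exact h1.sum_le_tsum _ fun j _ => dyadicSq_nonneg _ _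

theorem sum_Ico_birkhoffSum_dyadicSq_le {ω : Ω} {J : ℕ}
    (h : ∀ i, dyadicTail T Y J (T^[i] ω) < ⊤) (r N : ℕ) :
    ∑ j ∈ Finset.Ico J r, birkhoffSum T (dyadicSq T Y j) N ω ≤
      birkhoffSum T (fun ω => (dyadicTail T Y J ω).toReal) N ω := by
  unfold birkhoffSum
  rw [Finset.sum_comm]
  exact Finset.sum_le_sum fun i _ => sum_Ico_dyadicSq_le (h i) r

/-- The increments in the chaining bound are sums of length `2 ^ j` started at `T^[i] ω`, so their
squares add up to a Birkhoff sum of `dyadicSq`, up to the weight `j + 1`. -/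
theorem abs_birkhoffSum_le_sum (ω : Ω) {k r : ℕ} (hk : k < 2 ^ r) :
    |birkhoffSum T Y k ω| ≤ ∑ j ∈ Finset.range r,
      √((j : ℝ) + 1)⁻¹ * √(birkhoffSum T (dyadicSq T Y j) (2 ^ r) ω) := by
  have h := abs_sub_le_sum_sqrt (fun n => birkhoffSum T Y n ω) hk
  rw [birkhoffSum_zero, sub_zero] at h
  refine h.trans (Finset.sum_le_sum fun j _ => ?_)
  rw [← Real.sqrt_mul (by positivity)]
  refine Real.sqrt_le_sqrt (le_of_eq ?_)
  simp only [birkhoffSum_add, add_sub_cancel_left]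
  rw [birkhoffSum]
  simp only [dyadicSq, ← Finset.mul_sum]
  have : (j : ℝ) + 1 ≠ 0 := by positivity
  field_simp

theorem sum_inv_succ_le (r : ℕ) : ∑ j ∈ Finset.range r, ((j : ℝ) + 1)⁻¹ ≤ 1 + Real.log r := by
  have h := harmonic_le_one_add_log r
  rw [harmonic] at h
  push_cast at h
  exact h

/-- Scales below `J` are bounded one by one through `C`; the others together, by Cauchy–Schwarz
against the harmonic sum, where the small `δ` comes in. -/
theorem abs_birkhoffSum_le_of_birkhoffSum_dyadicTail_le {ω : Ω}
    (h : ∀ i J, dyadicTail T Y J (T^[i] ω) < ⊤) {C δ : ℝ} (hδ : 0 ≤ δ) {J : ℕ}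
    (h0 : ∀ n : ℕ, birkhoffSum T (fun ω => (dyadicTail T Y 0 ω).toReal) n ω ≤ n * C)
    (hJ : ∀ n : ℕ, birkhoffSum T (fun ω => (dyadicTail T Y J ω).toReal) n ω ≤ n * δ ^ 2)
    {k r : ℕ} (hk : k < 2 ^ r) :
    |birkhoffSum T Y k ω| ≤ √(2 ^ r) * (J * √C + δ * √(1 + Real.log r)) := by
  set b : ℕ → ℝ := fun j => birkhoffSum T (dyadicSq T Y j) (2 ^ r) ω with hb
  have hb0 : ∀ j, 0 ≤ b j := fun j => Finset.sum_nonneg fun i _ => dyadicSq_nonneg _ _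
  have hbC : ∀ j, b j ≤ 2 ^ r * C := by
    intro j
    have h1 := sum_Ico_birkhoffSum_dyadicSq_le (fun i => h i 0) (j + 1) (2 ^ r)
    have h2 := Finset.single_le_sum (f := b) (s := Finset.Ico 0 (j + 1)) (fun i _ => hb0 i)
      (Finset.mem_Ico.2 ⟨Nat.zero_le j, Nat.lt_succ_self j⟩)
    have h3 := h0 (2 ^ r)
    push_cast at h3
    exact h2.trans (h1.trans h3)
  have hterm : ∀ j : ℕ, √((j : ℝ) + 1)⁻¹ * √(b j) ≤ √(2 ^ r) * √C := by
    intro j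
    rw [← Real.sqrt_mul (by positivity) C]
    refine (mul_le_of_le_one_left (Real.sqrt_nonneg _) ?_).trans (Real.sqrt_le_sqrt (hbC j))
    exact Real.sqrt_le_one.2 (inv_le_one_of_one_le₀ (by linarith [(Nat.cast_nonneg j : (0 : ℝ) ≤ j)]))
  have hsplit : ∑ j ∈ Finset.range r, √((j : ℝ) + 1)⁻¹ * √(b j) ≤
      ∑ j ∈ Finset.range J, √((j : ℝ) + 1)⁻¹ * √(b j) +
        ∑ j ∈ Finset.Ico J r, √((j : ℝ) + 1)⁻¹ * √(b j) := by
    rcases le_total J r with hle | hle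
    · rw [Finset.sum_range_add_sum_Ico _ hle]
    · rw [Finset.Ico_eq_empty_of_le hle, Finset.sum_empty, add_zero]
      exact Finset.sum_le_sum_of_subset_of_nonneg (Finset.range_mono hle) fun _ _ _ => by positivity
  have hfirst : ∑ j ∈ Finset.range J, √((j : ℝ) + 1)⁻¹ * √(b j) ≤ J * (√(2 ^ r) * √C) := by
    refine (Finset.sum_le_card_nsmul _ _ _ fun j _ => hterm j).trans ?_
    simp
  have hsecond : ∑ j ∈ Finset.Ico J r, √((j : ℝ) + 1)⁻¹ * √(b j) ≤
      √(1 + Real.log r) * (√(2 ^ r) * δ) := by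
    refine (Real.sum_sqrt_mul_sqrt_le _ (fun j => by positivity) hb0).trans ?_
    have h1 : ∑ j ∈ Finset.Ico J r, ((j : ℝ) + 1)⁻¹ ≤ 1 + Real.log r := by
      refine le_trans (Finset.sum_le_sum_of_subset_of_nonneg (fun j hj => ?_)
        fun _ _ _ => by positivity) (sum_inv_succ_le r)
      exact Finset.mem_range.2 (Finset.mem_Ico.1 hj).2
    have h2 : √(∑ j ∈ Finset.Ico J r, b j) ≤ √(2 ^ r) * δ := by
      rw [← Real.sqrt_sq hδ, ← Real.sqrt_mul (by positivity)]
      refine Real.sqrt_le_sqrt ((sum_Ico_birkhoffSum_dyadicSq_le (fun i => h i J) r _).trans ?_)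
      have := hJ (2 ^ r)
      push_cast at this
      exact this
    gcongr
  linarith [abs_birkhoffSum_le_sum (T := T) (Y := Y) ω hk]

/-- If `∑ (j + 1) 2⁻ʲ E(R_{2ʲ}²) < ∞`, where `R_n = Y + ⋯ + Y ∘ T ^ (n - 1)`, then
`R_n = o((n log₂ n)^{1/2})` almost surely. -/
theorem ae_tendsto_birkhoffSum_div [IsFiniteMeasure μ] (hT : MeasurePreserving T μ μ)
    (hY : MemLp Y 2 μ) (hs : Summable fun j => ∫ ω, dyadicSq T Y j ω ∂μ) :
    ∀ᵐ ω ∂μ, Tendsto (fun n : ℕ => birkhoffSum T Y n ω / √((n : ℝ) * log₂ (n : ℝ)))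
      atTop (𝓝 0) := by
  have hfin : ∀ᵐ ω ∂μ, ∀ i J, dyadicTail T Y J (T^[i] ω) < ⊤ :=
    ae_all_iff.2 fun i => ae_all_iff.2 fun J =>
      (hT.iterate i).quasiMeasurePreserving.ae (ae_dyadicTail_lt_top hT hY hs J)
  have hC : ∀ᵐ ω ∂μ, ∃ m : ℕ, ∀ n : ℕ,
      birkhoffSum T (fun ω => (dyadicTail T Y 0 ω).toReal) n ω ≤ n * ((m : ℝ) + 1) := by
    refine ae_exists_birkhoffSum_le hT (fun _ => integrable_toReal_dyadicTail hT hY hs 0)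
      (fun _ _ => ENNReal.toReal_nonneg) (fun m => by positivity) ?_
    exact tendsto_const_nhds.div_atTop
      (tendsto_atTop_add_const_right _ _ tendsto_natCast_atTop_atTop)
  have hδ : ∀ᵐ ω ∂μ, ∀ p : ℕ, ∃ J : ℕ, ∀ n : ℕ,
      birkhoffSum T (fun ω => (dyadicTail T Y J ω).toReal) n ω ≤ n * (((p : ℝ) + 1)⁻¹) ^ 2 := by
    refine ae_all_iff.2 fun p => ae_exists_birkhoffSum_le hT
      (fun J => integrable_toReal_dyadicTail hT hY hs J) (fun _ _ => ENNReal.toReal_nonneg)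
      (fun _ => by positivity) ?_
    simp only [integral_toReal_dyadicTail hT hY hs]
    have h0 := (tendsto_sum_nat_add fun j => ∫ ω, dyadicSq T Y j ω ∂μ).div_const
      ((((p : ℝ) + 1)⁻¹) ^ 2)
    rwa [zero_div] at h0
  filter_upwards [hfin, hC, hδ] with ω h1 h2 h3
  obtain ⟨m, hm⟩ := h2
  refine tendsto_div_sqrt_mul_log₂ fun ε hε => ?_
  obtain ⟨p, hp⟩ := exists_nat_one_div_lt hε
  obtain ⟨J, hJ⟩ := h3 p
  refine ⟨J * √((m : ℝ) + 1), by positivity, fun r k hk => ?_⟩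
  refine (abs_birkhoffSum_le_of_birkhoffSum_dyadicTail_le h1 (by positivity) hm hJ hk).trans ?_
  gcongr
  rw [one_div] at hp
  exact hp.le

end DyadicSums

/-! ### Transfer along measure preserving maps -/

section Transfer

theorem condExp_comp_measurePreserving {Ω Ω' : Type*} {mΩ : MeasurableSpace Ω}
    {m mΩ' : MeasurableSpace Ω'} {μ : Measure Ω} {ν : Measure Ω'} [IsFiniteMeasure μ]
    [IsFiniteMeasure ν] {φ : Ω → Ω'} (hφ : MeasurePreserving φ μ ν) (hm : m ≤ mΩ') {g : Ω' → ℝ} (hg : Integrable g ν) :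
    μ[g ∘ φ | m.comap φ] =ᵐ[μ] ν[g | m] ∘ φ := by
  have hm' : m.comap φ ≤ mΩ := (MeasurableSpace.comap_mono hm).trans hφ.measurable.comap_le
  have hset : ∀ (h : Ω' → ℝ), Integrable h ν → ∀ A, MeasurableSet[m] A →
      ∫ ω in φ ⁻¹' A, (h ∘ φ) ω ∂μ = ∫ x in A, h x ∂ν := by
    intro h hh A hA
    have := setIntegral_map (μ := μ) (g := φ) (f := h) (hm A hA)
      (by rw [hφ.map_eq]; exact hh.aestronglyMeasurable) hφ.measurable.aemeasurable
    rw [hφ.map_eq] at this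
    exact this.symm
  refine (ae_eq_condExp_of_forall_setIntegral_eq hm' (hφ.integrable_comp_of_integrable hg)
    (fun s _ _ => (hφ.integrable_comp_of_integrable integrable_condExp).integrableOn) ?_ ?_).symm
  · rintro s ⟨A, hA, rfl⟩ -
    rw [hset _ integrable_condExp A hA, hset _ hg A hA, setIntegral_condExp hm hg hA]
  · exact (stronglyMeasurable_condExp.comp_measurable
      (comap_measurable φ)).aestronglyMeasurable
variable {Ω Ω' : Type*} {mΩ : MeasurableSpace Ω} {mΩ' : MeasurableSpace Ω'} {μ : Measure Ω}
  {ν : Measure Ω'} [IsFiniteMeasure μ] [IsFiniteMeasure ν] {φ : Ω → Ω'}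

theorem partialSum_succ (X : ℤ → Ω → ℝ) (n : ℕ) :
    partialSum X (n + 1) = partialSum X n + X n := by
  funext ω
  simp [partialSum, Finset.sum_range_succ]

theorem IsStationaryMartingaleDiff.of_condExp_eq_zero {ℱ : Filtration ℤ mΩ} {D : ℤ → Ω → ℝ}
    (hD : ∀ k, StronglyMeasurable[ℱ (k + 1)] (D k)) (hD2 : ∀ k, MemLp (D k) 2 μ)
    (hst : IsStationary D μ) (h0 : ∀ k, μ[D k | ℱ k] =ᵐ[μ] 0) :
    IsStationaryMartingaleDiff μ ℱ D where
  adapted := hD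
  memLp := hD2
  stationary := hst
  condExp_eq_zero := h0
  martingale := by
    have hint : ∀ k, Integrable (D k) μ := fun k => (hD2 k).integrable one_le_two
    refine martingale_of_condExp_sub_eq_zero_nat (fun n => ?_) (fun n => ?_) fun n => ?_
    · refine Finset.stronglyMeasurable_fun_sum _ fun i hi => ?_
      refine (hD i).mono (ℱ.mono ?_)
      have := Finset.mem_range.1 hi
      omega
    · exact integrable_finsetSum _ fun i _ => hint i
    · rw [partialSum_succ, add_sub_cancel_left]
      exact h0 n

theorem IsStationaryMartingaleDiff.comp {ℱ : Filtration ℤ mΩ} {ℱ' : Filtration ℤ mΩ'}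
    {D : ℤ → Ω' → ℝ} (h : IsStationaryMartingaleDiff ν ℱ' D) (hφ : MeasurePreserving φ μ ν)
    (hℱ : ∀ k, ℱ k = (ℱ' k).comap φ) :
    IsStationaryMartingaleDiff μ ℱ fun k => D k ∘ φ := by
  refine .of_condExp_eq_zero (fun k => ?_) (fun k => (h.memLp k).comp_measurePreserving hφ)
    (fun m => ?_) fun k => ?_
  · rw [hℱ]
    exact (h.adapted k).comp_measurable (comap_measurable φ)
  · have hst := h.stationary m
    have hm : ∀ k, Measurable (D k) := fun k => ((h.adapted k).mono (ℱ'.le _)).measurable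
    have h1 : Measurable fun x k => D (k + m) x := measurable_pi_lambda _ fun k => hm _
    have h2 : Measurable fun x k => D k x := measurable_pi_lambda _ fun k => hm _
    refine ⟨(h1.comp hφ.measurable).aemeasurable, (h2.comp hφ.measurable).aemeasurable, ?_⟩
    have h3 := hst.map_eq
    rw [← hφ.map_eq, Measure.map_map h1 hφ.measurable, Measure.map_map h2 hφ.measurable] at h3
    exact h3
  · rw [hℱ]
    refine (condExp_comp_measurePreserving hφ (ℱ'.le k) ((h.memLp k).integrable one_le_two)).trans ?_
    exact hφ.quasiMeasurePreserving.ae_eq_comp (h.condExp_eq_zero k)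

theorem logCondition_comp_iff {X : ℤ → Ω' → ℝ} (hX : ∀ k, Integrable (X k) ν)
    (hφ : MeasurePreserving φ μ ν) {F : MeasurableSpace Ω'} (hF : F ≤ mΩ') :
    LogCondition μ (F.comap φ) (fun k => X k ∘ φ) ↔ LogCondition ν F X := by
  have h : ∀ k : ℕ, eLpNorm (μ[partialSum (fun k => X k ∘ φ) k | F.comap φ]) 2 μ =
      eLpNorm (ν[partialSum X k | F]) 2 ν := by
    intro k
    have hint : Integrable (partialSum X k) ν := integrable_finsetSum _ fun i _ => hX i
    have h1 : partialSum (fun k => X k ∘ φ) k = partialSum X k ∘ φ := rfl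
    rw [h1, eLpNorm_congr_ae (condExp_comp_measurePreserving hφ hF hint),
      eLpNorm_comp_measurePreserving integrable_condExp.aestronglyMeasurable hφ]
  simp only [LogCondition, h]

end Transfer

theorem LogApprox.comp {Ω Ω' : Type*} {mΩ : MeasurableSpace Ω} {mΩ' : MeasurableSpace Ω'}
    {μ : Measure Ω} {ν : Measure Ω'} {φ : Ω → Ω'} {X D : ℤ → Ω' → ℝ}
    (h : LogApprox ν X D) (hφ : MeasurePreserving φ μ ν) :
    LogApprox μ (fun k => X k ∘ φ) fun k => D k ∘ φ :=
  hφ.quasiMeasurePreserving.ae h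

/-! ### Integer iterates of an invertible transformation -/

section Iterates

variable {Ω : Type*} {mΩ : MeasurableSpace Ω} {μ : Measure Ω} {T : Ω ≃ᵐ Ω}

theorem iter_zero (T : Ω ≃ᵐ Ω) : iter T 0 = id := by
  simp [iter]

theorem iter_add (T : Ω ≃ᵐ Ω) (k l : ℤ) : iter T (k + l) = iter T k ∘ iter T l := by
  funext ω
  simp [iter, zpow_add]

theorem iter_natCast (T : Ω ≃ᵐ Ω) (n : ℕ) : iter T n = T^[n] := by
  induction n with
  | zero => exact iter_zero T
  | succ n ih => rw [Nat.cast_succ, iter_succ, ih, Function.iterate_succ']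

theorem measurePreserving_iter (hT : MeasurePreserving T μ μ) (k : ℤ) :
    MeasurePreserving (iter T k) μ μ := by
  have hnat : ∀ n : ℕ, MeasurePreserving (iter T n) μ μ := fun n => by
    rw [iter_natCast]; exact hT.iterate n
  obtain ⟨n, rfl | rfl⟩ := k.eq_nat_or_neg
  · exact hnat n
  · refine ⟨measurable_iter T _, ?_⟩
    have h : iter T (-n : ℤ) ∘ iter T n = id := by
      rw [← iter_add, neg_add_cancel, iter_zero]
    conv_lhs => rw [← (hnat n).map_eq]
    rw [Measure.map_map (measurable_iter T _) (measurable_iter T _), h, Measure.map_id]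

theorem partialSum_comp_iter (T : Ω ≃ᵐ Ω) (Y : Ω → ℝ) (n : ℕ) :
    partialSum (fun k => Y ∘ iter T k) n = birkhoffSum T Y n := by
  funext ω
  simp [partialSum, birkhoffSum, iter_natCast]

theorem isStationary_comp_iter (hT : MeasurePreserving T μ μ) {Y : Ω → ℝ} (hY : Measurable Y) :
    IsStationary (fun k => Y ∘ iter T k) μ := by
  intro m
  have h : Measurable fun ω k => (Y ∘ iter T k) ω :=
    measurable_pi_lambda _ fun k => hY.comp (measurable_iter T k)
  have h1 : (fun ω k => (Y ∘ iter T (k + m)) ω) = (fun ω k => (Y ∘ iter T k) ω) ∘ iter T m := by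
    funext ω k
    simp [iter_add]
  rw [h1]
  refine ⟨(h.comp (measurable_iter T m)).aemeasurable, h.aemeasurable, ?_⟩
  rw [← Measure.map_map h (measurable_iter T m), (measurePreserving_iter hT m).map_eq]

end Iterates

theorem isStationaryMartingaleDiff_comp_iter {Ω : Type*} {F₀ mΩ : MeasurableSpace Ω}
    {μ : Measure Ω} [IsFiniteMeasure μ] {T : Ω ≃ᵐ Ω} (hT : MeasurePreserving T μ μ) (hF₀ : F₀ ≤ mΩ) (hF₀T : F₀ ≤ F₀.comap T) {d : Ω → ℝ}
    (hd : StronglyMeasurable[F₀] d) (hd2 : MemLp d 2 μ) (h0 : μ[d ∘ T | F₀] =ᵐ[μ] 0) :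
    IsStationaryMartingaleDiff μ (shiftFiltration T F₀ hF₀ hF₀T)
      (fun k => (d ∘ T) ∘ iter T k) := by
  have hdT2 : MemLp (d ∘ T) 2 μ := hd2.comp_measurePreserving hT
  refine .of_condExp_eq_zero (fun k => ?_)
    (fun k => hdT2.comp_measurePreserving (measurePreserving_iter hT k))
    (isStationary_comp_iter hT ((hd.mono hF₀).measurable.comp T.measurable)) fun k => ?_
  · rw [Function.comp_assoc, ← iter_succ]
    exact hd.comp_measurable (comap_measurable _)
  · refine (condExp_comp_measurePreserving (measurePreserving_iter hT k) hF₀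
      (hdT2.integrable one_le_two)).trans ?_
    exact (measurePreserving_iter hT k).quasiMeasurePreserving.ae_eq_comp h0

/-! ### The Koopman operator on `L²` -/

section Koopman

variable {Ω : Type*} {mΩ : MeasurableSpace Ω} {μ : Measure Ω}

/-- Composition with a measure preserving map, as an operator on `L²`. -/
noncomputable def koopman {T : Ω → Ω} (hT : MeasurePreserving T μ μ) :
    Lp ℝ 2 μ →L[ℝ] Lp ℝ 2 μ :=
  (Lp.compMeasurePreservingₗᵢ ℝ T hT).toContinuousLinearMap

theorem norm_koopman_apply {T : Ω → Ω} (hT : MeasurePreserving T μ μ) (g : Lp ℝ 2 μ) :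
    ‖koopman hT g‖ = ‖g‖ :=
  (Lp.compMeasurePreservingₗᵢ ℝ T hT).norm_map g

theorem koopman_toLp {T : Ω → Ω} (hT : MeasurePreserving T μ μ) {g : Ω → ℝ} (hg : MemLp g 2 μ) :
    koopman hT hg.toLp = (hg.comp_measurePreserving hT).toLp := rfl

theorem koopman_pow_toLp {T : Ω → Ω} (hT : MeasurePreserving T μ μ) {g : Ω → ℝ}
    (hg : MemLp g 2 μ) (n : ℕ) :
    (koopman hT ^ n) hg.toLp = (hg.comp_measurePreserving (hT.iterate n)).toLp := by
  induction n with
  | zero => rfl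
  | succ n ih =>
    rw [pow_succ', mul_apply_eq_comp, ih, koopman_toLp]
    rfl

theorem opSum_koopman_toLp {T : Ω → Ω} (hT : MeasurePreserving T μ μ) {g : Ω → ℝ}
    (hg : MemLp g 2 μ) (n : ℕ) :
    opSum (koopman hT) n hg.toLp = (memLp_birkhoffSum hT hg n).toLp := by
  induction n with
  | zero => simp [opSum]
  | succ n ih =>
    rw [opSum_succ, add_apply, ih, koopman_pow_toLp, ← MemLp.toLp_add]
    refine MemLp.toLp_congr _ _ (Eventually.of_forall fun ω => ?_)
    rw [birkhoffSum_succ]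
    rfl

end Koopman

/-! ### The case of an invertible transformation -/

section InvertibleTransformation

theorem starProjection_lpMeas_toLp_ae_eq {Ω : Type*} {m mΩ : MeasurableSpace Ω} {μ : Measure Ω}
    [IsFiniteMeasure μ] (hm : m ≤ mΩ) [(lpMeas ℝ ℝ m 2 μ).HasOrthogonalProjection] {g : Ω → ℝ}
    (hg : MemLp g 2 μ) :
    ((lpMeas ℝ ℝ m 2 μ).starProjection hg.toLp : Ω → ℝ) =ᵐ[μ] μ[g | m] :=
  hg.condExpL2_ae_eq_condExp (𝕜 := ℝ) hm

theorem eLpNorm_condExp_eq_ofReal {Ω : Type*} {m mΩ : MeasurableSpace Ω} {μ : Measure Ω}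
    [IsFiniteMeasure μ] (hm : m ≤ mΩ) [(lpMeas ℝ ℝ m 2 μ).HasOrthogonalProjection] {g : Ω → ℝ}
    (hg : MemLp g 2 μ) :
    eLpNorm (μ[g | m]) 2 μ =
      ENNReal.ofReal ‖(lpMeas ℝ ℝ m 2 μ).starProjection hg.toLp‖ := by
  rw [Lp.norm_def, ENNReal.ofReal_toReal (Lp.eLpNorm_ne_top _),
    eLpNorm_congr_ae (starProjection_lpMeas_toLp_ae_eq hm hg)]

/-- The inclusion `F₀ ≤ F₀.comap T` says that `T.symm` is measurable from `F₀` to `F₀`, so composing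
with it stays in the subspace. -/
theorem exists_koopman_eq_of_mem_lpMeas {Ω : Type*} {F₀ mΩ : MeasurableSpace Ω} {μ : Measure Ω}
    {T : Ω ≃ᵐ Ω} (hT : MeasurePreserving T μ μ) (hF₀T : F₀ ≤ F₀.comap T) {x : Lp ℝ 2 μ}
    (hx : x ∈ lpMeas ℝ ℝ F₀ 2 μ) : ∃ y ∈ lpMeas ℝ ℝ F₀ 2 μ, koopman hT y = x := by
  rw [mem_lpMeas_iff_aestronglyMeasurable] at hx
  obtain ⟨g, hg, hxg⟩ := hx
  have hsymm : Measurable[F₀, F₀] T.symm := by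
    intro A hA
    obtain ⟨B, hB, rfl⟩ := hF₀T A hA
    rw [← Set.preimage_comp]
    simpa using hB
  have hg2 : MemLp g 2 μ := (memLp_congr_ae hxg).1 (Lp.memLp x)
  have hgT : MemLp (g ∘ T.symm) 2 μ := hg2.comp_measurePreserving (hT.symm T)
  refine ⟨hgT.toLp, ?_, ?_⟩
  · rw [mem_lpMeas_iff_aestronglyMeasurable]
    exact ⟨g ∘ T.symm, hg.comp_measurable hsymm, hgT.coeFn_toLp⟩
  · rw [koopman_toLp, ← Lp.toLp_coeFn x (Lp.memLp x)]
    refine MemLp.toLp_congr _ _ ?_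
    filter_upwards [hxg] with ω hω
    rw [hω]
    simp

theorem integral_dyadicSq_eq {Ω : Type*} {mΩ : MeasurableSpace Ω} {μ : Measure Ω} {T : Ω → Ω}
    (hT : MeasurePreserving T μ μ) {Y : Ω → ℝ} (hY : MemLp Y 2 μ) (j : ℕ) :
    ∫ ω, dyadicSq T Y j ω ∂μ =
      ((j : ℝ) + 1) * ((2 ^ j)⁻¹ * ‖opSum (koopman hT) (2 ^ j) hY.toLp‖ ^ 2) := by
  rw [opSum_koopman_toLp, ← real_inner_self_eq_norm_sq, L2.inner_def]
  simp only [dyadicSq]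
  rw [integral_const_mul, mul_assoc]
  congr 2
  refine integral_congr_ae ?_
  filter_upwards [(memLp_birkhoffSum hT hY (2 ^ j)).coeFn_toLp] with ω hω
  rw [hω, real_inner_self_eq_norm_sq, Real.norm_eq_abs, sq_abs]

theorem exists_martingale_approx_of_measurePreserving {Ω : Type*} {F₀ mΩ : MeasurableSpace Ω}
    {μ : Measure Ω} [IsProbabilityMeasure μ] {T : Ω ≃ᵐ Ω} (hT : MeasurePreserving T μ μ)
    (hF₀ : F₀ ≤ mΩ) (hF₀T : F₀ ≤ F₀.comap T) {X₀ : Ω → ℝ} (hX : Measurable[F₀] X₀)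
    (hX2 : MemLp X₀ 2 μ) (hlog : LogCondition μ F₀ fun k => X₀ ∘ iter T k) :
    ∃ D₀ : Ω → ℝ, IsStationaryMartingaleDiff μ (shiftFiltration T F₀ hF₀ hF₀T)
      (fun k => D₀ ∘ iter T k) ∧
      LogApprox μ (fun k => X₀ ∘ iter T k) fun k => D₀ ∘ iter T k := by
  have : Fact (F₀ ≤ mΩ) := ⟨hF₀⟩
  set K := lpMeas ℝ ℝ F₀ 2 μ with hKdef
  set U := koopman hT with hUdef
  have hU : ∀ x, ‖U x‖ = ‖x‖ := norm_koopman_apply hT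
  have hK : ∀ x ∈ K, ∃ y ∈ K, U y = x := fun x hx => exists_koopman_eq_of_mem_lpMeas hT hF₀T hx
  have hfK : hX2.toLp ∈ K := by
    rw [hKdef, mem_lpMeas_iff_aestronglyMeasurable]
    exact ⟨X₀, hX.stronglyMeasurable, hX2.coeFn_toLp⟩
  set a : ℕ → ℝ := fun k => ‖K.starProjection (opSum U k hX2.toLp)‖ with ha
  have ha0 : ∀ k, 0 ≤ a k := fun k => norm_nonneg _
  have hsub : ∀ i k, a i ≤ a (i + k) + a k := fun i k => by
    simp only [ha, starProjection_opSum_apply hU hK _ hfK]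
    exact norm_opSum_apply_le_add (norm_compression_apply_le hU) i k _
  have hnorm : ∀ k : ℕ, eLpNorm (μ[partialSum (fun k => X₀ ∘ iter T k) k | F₀]) 2 μ =
      ENNReal.ofReal (a k) := fun k => by
    rw [partialSum_comp_iter, eLpNorm_condExp_eq_ofReal hF₀ (memLp_birkhoffSum hT hX2 k)]
    simp only [ha, hUdef, opSum_koopman_toLp]
    rfl
  simp only [LogCondition, hnorm] at hlog
  obtain ⟨hw, hlogw⟩ := summable_of_tsum_Ici_lt_top ha0 hlog
  set w : ℕ → ℝ := fun k => a k / (k : ℝ) ^ (3 / 2 : ℝ) with hwdef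
  have hw0 : ∀ k, 0 ≤ w k := fun k => div_nonneg (ha0 k) (by positivity)
  have he : Tendsto (fun s => 32 * tailSum w (2 ^ s)) atTop (𝓝 0) := by
    have := ((tendsto_sum_nat_add w).comp
      (tendsto_pow_atTop_atTop_of_one_lt one_lt_two)).const_mul 32
    simpa [tailSum, Function.comp_def] using this
  obtain ⟨y, hyK, hy0, hy⟩ := exists_martingaleDiff_approx hU hK hfK he
    (fun s i hi => (le_sqrt_two_pow_mul_tailSum ha0 hsub hw s i hi).trans
      (mul_le_mul_of_nonneg_left
        (show 16 * (tailSum w (2 ^ s) - tailSum w (2 ^ (s + 2))) ≤ 32 * tailSum w (2 ^ s) by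
          linarith [tailSum_nonneg hw0 (2 ^ (s + 2)), tailSum_nonneg hw0 (2 ^ s)])
        (by positivity)))
    (sum_Ico_inv_sqrt_two_pow_mul_le ha0 hsub hw)
  obtain ⟨d, hd, hyd⟩ := mem_lpMeas_iff_aestronglyMeasurable.1 hyK
  have hd2 : MemLp d 2 μ := (memLp_congr_ae hyd).1 (Lp.memLp y)
  have hyd' : y = hd2.toLp := by
    rw [← Lp.toLp_coeFn y (Lp.memLp y)]
    exact MemLp.toLp_congr _ _ hyd
  have hdT2 : MemLp (d ∘ T) 2 μ := hd2.comp_measurePreserving hT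
  rw [hyd', hUdef, koopman_toLp] at hy0 hy
  -- With `d` measurable for `ℱ₀`, `d ∘ T` is measurable for `ℱ₁`: this is the shift of index in the
  -- adaptedness of `D_k`.
  refine ⟨d ∘ T, isStationaryMartingaleDiff_comp_iter hT hF₀ hF₀T hd hd2 ?_, ?_⟩
  · have h1 := starProjection_lpMeas_toLp_ae_eq hF₀ hdT2
    rw [hy0] at h1
    exact h1.symm.trans (Lp.coeFn_zero _ _ _)
  · have hY : MemLp (X₀ - d ∘ T) 2 μ := hX2.sub hdT2
    have hs : Summable fun j => ∫ ω, dyadicSq T (X₀ - d ∘ T) j ω ∂μ := by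
      -- The constant `256` is `8 * 32`: the factor of the approximation times that in the choice of
      -- its error sequence.
      refine Summable.of_nonneg_of_le (fun j => integral_nonneg fun ω => dyadicSq_nonneg _ _)
        (fun j => ?_) ((summable_mul_tailSum_two_pow hw0 hw hlogw).mul_left (256 ^ 2))
      rw [integral_dyadicSq_eq hT hY, MemLp.toLp_sub hX2 hdT2, map_sub]
      have h2 : (2 : ℝ) ^ j = √2 ^ j * √2 ^ j := by
        rw [← mul_pow, Real.mul_self_sqrt zero_le_two]
      calc ((j : ℝ) + 1) * ((2 ^ j)⁻¹ * ‖opSum (koopman hT) (2 ^ j) hX2.toLp -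
              opSum (koopman hT) (2 ^ j) hdT2.toLp‖ ^ 2)
          ≤ ((j : ℝ) + 1) * ((2 ^ j)⁻¹ * (√2 ^ j * (8 * (32 * tailSum w (2 ^ j)))) ^ 2) := by
            gcongr
            exact hy j
        _ = 256 ^ 2 * (((j : ℝ) + 1) * tailSum w (2 ^ j) ^ 2) := by
            rw [h2]
            have : √2 ^ j ≠ 0 := by positivity
            field_simp
            ring
    filter_upwards [ae_tendsto_birkhoffSum_div hT hY hs] with ω hω
    simpa only [partialSum_comp_iter, birkhoffSum_sub] using hω

end InvertibleTransformation

/-! ### Path space and stationary processes -/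

section PathSpace

variable {S : Type*} [mS : MeasurableSpace S]

/-- The shift of two-sided sequences. -/
def pathShift (S : Type*) [MeasurableSpace S] : (ℤ → S) ≃ᵐ (ℤ → S) where
  toFun y k := y (k + 1)
  invFun y k := y (k - 1)
  left_inv y := by funext k; simp
  right_inv y := by funext k; simp
  measurable_toFun := measurable_pi_lambda _ fun k => measurable_pi_apply _
  measurable_invFun := measurable_pi_lambda _ fun k => measurable_pi_apply _

theorem iter_pathShift (k : ℤ) (y : ℤ → S) (j : ℤ) : iter (pathShift S) k y j = y (j + k) := by
  induction k using Int.induction_on generalizing j with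
  | zero => simp [iter_zero]
  | succ n ih =>
    rw [iter_succ]
    exact (ih (j + 1)).trans (by congr 1; ring)
  | pred n ih =>
    have h := iter_succ (pathShift S) (-(n : ℤ) - 1)
    rw [sub_add_cancel] at h
    rw [h] at ih
    have h2 : iter (pathShift S) (-(n : ℤ) - 1) y (j - 1 + 1) = y (j - 1 + -n) := ih (j - 1)
    rw [sub_add_cancel] at h2
    rw [h2]
    congr 1
    ring

/-- The σ-algebra generated by the coordinates of nonpositive index. -/
abbrev pathPast (S : Type*) [mS : MeasurableSpace S] : MeasurableSpace (ℤ → S) :=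
  ⨆ i : Set.Iic (0 : ℤ), mS.comap fun y => y i

theorem comap_iter_pathPast (k : ℤ) :
    (pathPast S).comap (iter (pathShift S) k) = ⨆ i : Set.Iic k, mS.comap fun y : ℤ → S => y i := by
  have h : ∀ i : ℤ, (fun y : ℤ → S => y i) ∘ iter (pathShift S) k = fun y => y (i + k) :=
    fun i => funext fun y => iter_pathShift k y i
  simp only [pathPast, MeasurableSpace.comap_iSup, MeasurableSpace.comap_comp, h]
  refine le_antisymm (iSup_le fun i => ?_) (iSup_le fun i => ?_)
  · exact le_iSup (fun j : Set.Iic k => mS.comap fun y : ℤ → S => y j)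
      ⟨i + k, by have := i.2; simp only [Set.mem_Iic] at this ⊢; omega⟩
  · have := le_iSup (fun j : Set.Iic (0 : ℤ) => mS.comap fun y : ℤ → S => y (j + k))
      ⟨i - k, by have := i.2; simp only [Set.mem_Iic] at this ⊢; omega⟩
    simpa using this

theorem pathPast_le : pathPast S ≤ MeasurableSpace.pi :=
  iSup_le fun i => (measurable_pi_apply (i : ℤ)).comap_le

theorem pathPast_le_comap : pathPast S ≤ (pathPast S).comap (pathShift S) := by
  have h := comap_iter_pathPast (S := S) 1
  have h1 : iter (pathShift S) 1 = pathShift S := by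
    have := iter_succ (pathShift S) 0
    rwa [iter_zero, zero_add] at this
  rw [h1] at h
  rw [h]
  exact iSup_le fun i => le_iSup (fun j : Set.Iic (1 : ℤ) => mS.comap fun y : ℤ → S => y j)
    ⟨i, by have := i.2; simp only [Set.mem_Iic] at this ⊢; omega⟩

theorem pastFiltration_eq_comap {Ω : Type*} [MeasurableSpace Ω] {ξ : ℤ → Ω → S}
    (hξ : ∀ k, Measurable (ξ k)) (k : ℤ) :
    pastFiltration ξ hξ k = (shiftFiltration (pathShift S) (pathPast S) pathPast_le
      pathPast_le_comap k).comap fun ω j => ξ j ω := by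
  change (⨆ i : Set.Iic k, mS.comap (ξ i)) = ((pathPast S).comap (iter (pathShift S) k)).comap _
  rw [comap_iter_pathPast, MeasurableSpace.comap_iSup]
  simp only [MeasurableSpace.comap_comp]
  rfl

/-- Stationarity means that the shift preserves the law `ν` of the path. The filtration and the
hypothesis are pullbacks from path space, so the differences built there can be composed with the
path map. -/
theorem exists_martingale_approx_of_isStationary {Ω : Type*} [MeasurableSpace Ω] {μ : Measure Ω}
    [IsProbabilityMeasure μ] {ξ : ℤ → Ω → S} (hξ : ∀ k, Measurable (ξ k))
    (hst : IsStationary ξ μ) {f : S → ℝ} (hf : Measurable f) (hf2 : MemLp f 2 (μ.map (ξ 0)))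
    (hlog : LogCondition μ (pastFiltration ξ hξ 0) fun k => f ∘ ξ k) :
    ∃ D : ℤ → Ω → ℝ, IsStationaryMartingaleDiff μ (pastFiltration ξ hξ) D ∧
      LogApprox μ (fun k => f ∘ ξ k) D := by
  set φ : Ω → ℤ → S := fun ω j => ξ j ω with hφdef
  have hφm : Measurable φ := measurable_pi_lambda _ hξ
  set ν := μ.map φ with hν
  have hφ : MeasurePreserving φ μ ν := ⟨hφm, rfl⟩
  have : IsProbabilityMeasure ν := Measure.isProbabilityMeasure_map hφm.aemeasurable
  have hT : MeasurePreserving (pathShift S) ν ν := by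
    refine ⟨(pathShift S).measurable, ?_⟩
    rw [hν, Measure.map_map (pathShift S).measurable hφm]
    exact (hst 1).map_eq
  have heval : MeasurePreserving (fun y : ℤ → S => y 0) ν (μ.map (ξ 0)) := by
    refine ⟨measurable_pi_apply _, ?_⟩
    rw [hν, Measure.map_map (measurable_pi_apply _) hφm]
    rfl
  set X₀ : (ℤ → S) → ℝ := fun y => f (y 0) with hX₀
  have hX2 : MemLp X₀ 2 ν := hf2.comp_measurePreserving heval
  have hX : Measurable[pathPast S] X₀ := by
    refine hf.comp ((comap_measurable fun y : ℤ → S => y 0).mono ?_ le_rfl)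
    exact le_iSup (fun j : Set.Iic (0 : ℤ) => mS.comap fun y : ℤ → S => y j) ⟨0, le_refl (0 : ℤ)⟩
  have hXφ : (fun k => (X₀ ∘ iter (pathShift S) k) ∘ φ) = fun k => f ∘ ξ k := by
    funext k ω
    simp [hX₀, hφdef, iter_pathShift]
  have hlog' : LogCondition ν (pathPast S) fun k => X₀ ∘ iter (pathShift S) k := by
    refine (logCondition_comp_iff (fun k => (hX2.comp_measurePreserving
      (measurePreserving_iter hT k)).integrable one_le_two) hφ pathPast_le).1 ?_
    have h0 : pastFiltration ξ hξ 0 = (pathPast S).comap φ := by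
      rw [pastFiltration_eq_comap]
      change ((pathPast S).comap (iter (pathShift S) 0)).comap φ = _
      rw [iter_zero, MeasurableSpace.comap_id]
    rw [← h0, hXφ]
    exact hlog
  obtain ⟨D₀, hD, hDlog⟩ := exists_martingale_approx_of_measurePreserving hT pathPast_le
    pathPast_le_comap hX hX2 hlog'
  refine ⟨fun k => (D₀ ∘ iter (pathShift S) k) ∘ φ, hD.comp hφ (pastFiltration_eq_comap hξ), ?_⟩
  rw [← hXφ]
  exact hDlog.comp hφ

end PathSpace

end MartApprox

theorem mainTheorem4 {Ω : Type*} [mΩ : MeasurableSpace Ω] (μ : Measure Ω)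
    [IsProbabilityMeasure μ] :
    -- measure preserving transformations: `X_k = X₀ ∘ T ^ k`, `ℱ_k = T ^ {-k}(ℱ₀)`
    (∀ T : Ω ≃ᵐ Ω, MeasurePreserving T μ μ →
      ∀ (F₀ : MeasurableSpace Ω) (hF₀ : F₀ ≤ mΩ) (hT : F₀ ≤ F₀.comap T) (X₀ : Ω → ℝ),
      Measurable[F₀] X₀ → MemLp X₀ 2 μ → ∫ ω, X₀ ω ∂μ = 0 →
      MartApprox.LogCondition μ F₀ (fun k => X₀ ∘ MartApprox.iter T k) →
      ∃ D₀ : Ω → ℝ,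
        MartApprox.IsStationaryMartingaleDiff μ (MartApprox.shiftFiltration T F₀ hF₀ hT)
          (fun k => D₀ ∘ MartApprox.iter T k) ∧
        MartApprox.LogApprox μ (fun k => X₀ ∘ MartApprox.iter T k)
          (fun k => D₀ ∘ MartApprox.iter T k)) ∧
    -- functions of a stationary Markov chain: `X_k = f(ξ_k)`, `ℱ_k = σ(ξ_i, i ≤ k)`
    (∀ {S : Type*} [MeasurableSpace S] (ξ : ℤ → Ω → S) (hξ : ∀ k, Measurable (ξ k))
        (f : S → ℝ),
      MartApprox.IsStationaryMarkovChain ξ hξ μ → Measurable f → MemLp f 2 (μ.map (ξ 0)) →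
      ∫ s, f s ∂(μ.map (ξ 0)) = 0 →
      MartApprox.LogCondition μ (MartApprox.pastFiltration ξ hξ 0) (fun k => f ∘ ξ k) →
      ∃ D : ℤ → Ω → ℝ,
        MartApprox.IsStationaryMartingaleDiff μ (MartApprox.pastFiltration ξ hξ) D ∧
        MartApprox.LogApprox μ (fun k => f ∘ ξ k) D) := by
  refine ⟨fun T hT F₀ hF₀ hF₀T X₀ hX hX2 _ hlog =>
      MartApprox.exists_martingale_approx_of_measurePreserving hT hF₀ hF₀T hX hX2 hlog,
    fun ξ hξ f hst hf hf2 _ hlog =>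
      MartApprox.exists_martingale_approx_of_isStationary hξ hst.1 hf hf2 hlog⟩
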